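/- Let $\mathcal H$ be a complex Hilbert space, $\mathcal A=\mathcal L(\mathcal H)$ the $C^*$-algebra of bounded operators on it, and $\omega$ a state on $\mathcal A$ (a continuous linear functional with $\omega(a^*a)\ge 0$ for all $a\in\mathcal A$ and $\omega(1)=1$). For a real vector space $E$ let $\Lambda E$ be its Grassmann (exterior) algebra and let $\mathcal G(E)=\mathrm{Hom}(\Lambda E,\mathcal A)$ be the set of unital real-algebra homomorphisms $\Lambda E\to\mathcal A$. Let $\Delta:\Lambda E\to\Lambda E\otimes\Lambda E$ be the coproduct, i.e. the algebra homomorphism into the $\mathbb Z_2$-graded tensor product with $\Delta v=v\otimes 1+1\otimes v$ for $v\in E$. Let $\partial_R=(\mathbb I\otimes\Pi_E)\Delta:\Lambda E\to\Lambda E\otimes E$, with $\Pi_E$ the projection on degree one, and $\partial_R^2=(\partial_R\otimes\mathbb I)\partial_R$. If $E$ is a real pre-Hilbert space and $C:E\to E$ is bounded and antisymmetric, $X\in\mathcal G(E)$ is called Gaussian with correlation $C$ if $X|_E$ is continuous and $\omega(X(G)X(f))=\omega(X(\langle\partial_R G,Cf\rangle))$ for all $G\in\Lambda E$, $f\in E$,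 where $\langle g\otimes v,w\rangle=\langle v,w\rangle g$. Let $V$ be a finite-dimensional real Hilbert space and $C:V\to V$ linear and antisymmetric. Let $B=(B_t)_{t\ge0}$ be a Brownian motion with correlation $C$, that is, $B_t\in\mathcal G(V)$ and $B_t(v)=\Xi(\mathbb 1_{[0,t]}\otimes v)$ for $v\in V$, where $\Xi\in\mathcal G(L^2(\mathbb R;V))$ is a Gaussian variable whose correlation is the pointwise action $f\mapsto Cf$ (a white noise). Let $F:V\to\Lambda V$ be linear with $F(v)$ odd for every $v\in V$. Let $\Psi_0\in\mathcal G(V)$ be compatible with and independent of $B$: writing $\hat B\in\mathcal G\big(\bigoplus_{t\ge0}V\big)$ for the homomorphism that equals $B_t$ on the $t$-th summand, the map $(v,w)\mapsto\Psi_0(v)+\hat B(w)$ extends to an element of $\mathcal G\big(V\oplus\bigoplus_{t\ge 0}V\big)$, and $\omega(\Psi_0(P)\hat B(Q))=\omega(\Psi_0(P))\,\omega(\hat B(Q))$ for all $P\in \Lambda V$ and $Q\in\Lambda\big(\bigoplus_{t\ge 0}V\big)$. Let $\Psi:[0,\infty)\to\mathcal G(V)$ be a global solution of the additive Grassmann SDE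 with drift $F$ and initial condition $\Psi_0$: $\Psi$ is continuous for the metric $d(X,Y)=\sup_{|v|=1}\|X(v)-Y(v)\|_{\mathcal A}$ and $$\Psi_t(v)=\Psi_0(v)+\int_0^t\Psi_s(F(v))\,ds+B_t(v),\qquad t\ge0,\ v\in V,$$ with the integral in Bochner's sense in $\mathcal A$. Then for all $G,H\in\Lambda V$ and all $t\ge0$ the integrand below is integrable on $[0,t]$ and $$\omega(\Psi_t(G)\Psi_0(H))=\omega(\Psi_0(G)\Psi_0(H))+\int_0^t\omega\Big[\Psi_s\Big(\partial_R G\cdot F+\tfrac12 Q_C(\partial_R^2G)\Big)\Psi_0(H)\Big]\,ds,$$ where $\cdot$ and $Q_C$ are the linear extensions of $(f\otimes v)\cdot F=fF(v)$ and $Q_C(f\otimes v\otimes w)=\langle v,Cw\rangle f$ for $f\in\Lambda V$, $v,w\in V$. -/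

import Mathlib

open MeasureTheory
open scoped TensorProduct NNReal

noncomputable section

namespace Grassmann

/-! ### The Grassmann algebra: parity, coproduct, right derivative

For a real vector space `E` the Grassmann algebra `ΛE` is Mathlib's `ExteriorAlgebra ℝ E`, which is
by definition the Clifford algebra of the zero quadratic form. -/

section Algebra

variable (E : Type*) [AddCommGroup E] [Module ℝ E]

/-- The `ℤ/2`-grading of `ΛE`: `parity E 0` is the even part and `parity E 1` the odd part. -/
abbrev parity : ZMod 2 → Submodule ℝ (ExteriorAlgebra ℝ E) :=
  CliffordAlgebra.evenOdd (0 : QuadraticForm ℝ E)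

/-- The `ℤ/2`-graded tensor product algebra `ΛE ⊗ ΛE`, whose multiplication is
`(f ⊗ g)(h ⊗ k) = (-1)^(|g||h|) fh ⊗ gk` for homogeneous `g`, `h`. -/
abbrev SuperTensor : Type _ :=
  GradedTensorProduct ℝ (parity E) (parity E)

variable {E} in
/-- The primitive element `v ⊗ 1 + 1 ⊗ v` of the super tensor product. -/
def primitive : E →ₗ[ℝ] SuperTensor E :=
  (GradedTensorProduct.includeLeft (parity E) (parity E)).toLinearMap ∘ₗ ExteriorAlgebra.ι ℝ
    + (GradedTensorProduct.includeRight (parity E) (parity E)).toLinearMap ∘ₗ ExteriorAlgebra.ι ℝ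

variable {E} in
theorem primitive_apply (v : E) :
    primitive v = GradedTensorProduct.of ℝ (parity E) (parity E) (ExteriorAlgebra.ι ℝ v ⊗ₜ[ℝ] 1)
      + GradedTensorProduct.of ℝ (parity E) (parity E) (1 ⊗ₜ[ℝ] ExteriorAlgebra.ι ℝ v) :=
  rfl

variable {E} in
theorem primitive_sq (v : E) : primitive v * primitive v = 0 := by
  have hp : primitive v =
      CliffordAlgebra.ofProd (0 : QuadraticForm ℝ E) 0 (CliffordAlgebra.ι _ (v, v)) := by
    rw [CliffordAlgebra.ofProd_ι_mk]
    rfl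
  rw [hp, ← map_mul, CliffordAlgebra.ι_sq_scalar]
  simp

/-- The coproduct: the algebra homomorphism `Δ : ΛE → ΛE ⊗ ΛE` (graded tensor product) with
`Δ v = v ⊗ 1 + 1 ⊗ v` for `v ∈ E`. -/
def coproduct : ExteriorAlgebra ℝ E →ₐ[ℝ] SuperTensor E :=
  ExteriorAlgebra.lift ℝ ⟨primitive, primitive_sq⟩

/-- The right derivative `∂_R = (1 ⊗ Π_E) ∘ Δ : ΛE → ΛE ⊗ E`, where `Π_E : ΛE → E` is the
projection on the elements of degree one. -/
def rightDeriv : ExteriorAlgebra ℝ E →ₗ[ℝ] ExteriorAlgebra ℝ E ⊗[ℝ] E :=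
  LinearMap.lTensor (ExteriorAlgebra ℝ E) (ExteriorAlgebra.ιInv (R := ℝ) (M := E))
    ∘ₗ (GradedTensorProduct.of ℝ (parity E) (parity E)).symm.toLinearMap
    ∘ₗ (coproduct E).toLinearMap

/-- The second right derivative `∂_R² = (∂_R ⊗ 1) ∘ ∂_R : ΛE → ΛE ⊗ E ⊗ E`. -/
def rightDeriv₂ : ExteriorAlgebra ℝ E →ₗ[ℝ] (ExteriorAlgebra ℝ E ⊗[ℝ] E) ⊗[ℝ] E :=
  LinearMap.rTensor E (rightDeriv E) ∘ₗ rightDeriv E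

variable {E} in
/-- The product `K · F ∈ ΛE` of `K ∈ ΛE ⊗ E` and a linear map `F : E → ΛE`, which is the linear
extension of `(f ⊗ v) · F = f F(v)`. -/
def dot (F : E →ₗ[ℝ] ExteriorAlgebra ℝ E) :
    ExteriorAlgebra ℝ E ⊗[ℝ] E →ₗ[ℝ] ExteriorAlgebra ℝ E :=
  LinearMap.mul' ℝ (ExteriorAlgebra ℝ E) ∘ₗ LinearMap.lTensor (ExteriorAlgebra ℝ E) F

end Algebra

section Inner

variable {E : Type*} [NormedAddCommGroup E] [InnerProductSpace ℝ E]

/-- The pairing `⟨K, w⟩ ∈ ΛE` of `K ∈ ΛE ⊗ E` with `w ∈ E`, which is the linear extension of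
`⟨f ⊗ v, w⟩ = ⟨v, w⟩ f`. It is written as a bilinear map, with `w` as its first argument. -/
def pair : E →ₗ[ℝ] ExteriorAlgebra ℝ E ⊗[ℝ] E →ₗ[ℝ] ExteriorAlgebra ℝ E :=
  LinearMap.compRight ℝ (TensorProduct.rid ℝ (ExteriorAlgebra ℝ E)).toLinearMap
    ∘ₗ LinearMap.lTensorHom (ExteriorAlgebra ℝ E) ∘ₗ innerₗ E

theorem pair_tmul (w v : E) (f : ExteriorAlgebra ℝ E) :
    pair w (f ⊗ₜ[ℝ] v) = inner ℝ v w • f := by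
  simp [pair, real_inner_comm]

/-- The map `Q_C : ΛE ⊗ E ⊗ E → ΛE`, which is the linear extension of
`Q_C (f ⊗ v ⊗ w) = ⟨v, C w⟩ f`. -/
def quad (C : E →L[ℝ] E) :
    (ExteriorAlgebra ℝ E ⊗[ℝ] E) ⊗[ℝ] E →ₗ[ℝ] ExteriorAlgebra ℝ E :=
  TensorProduct.lift (pair ∘ₗ C.toLinearMap).flip

theorem quad_tmul (C : E →L[ℝ] E) (f : ExteriorAlgebra ℝ E) (v w : E) :
    quad C ((f ⊗ₜ[ℝ] v) ⊗ₜ[ℝ] w) = inner ℝ v (C w) • f := by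
  simp [quad, pair_tmul]

/-- The operator `G ↦ ∂_R G · F + ½ Q_C (∂_R² G)` on `ΛE`. -/
def generator (F : E →ₗ[ℝ] ExteriorAlgebra ℝ E) (C : E →L[ℝ] E) (G : ExteriorAlgebra ℝ E) :
    ExteriorAlgebra ℝ E :=
  dot F (rightDeriv E G) + (1 / 2 : ℝ) • quad C (rightDeriv₂ E G)

end Inner

/-! ### Grassmann random variables -/

section Probability

variable (A : Type*) [NormedRing A] [StarRing A] [NormedAlgebra ℂ A]

/-- States: continuous linear functionals which are positive and normalized. -/
structure IsState (ω : A →L[ℂ] ℂ) : Prop where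
  nonneg : ∀ a : A, 0 ≤ (ω (star a * a)).re ∧ (ω (star a * a)).im = 0
  map_one : ω 1 = 1

/-- `E`-Grassmann random variables with values in `A`: (unital, real) algebra homomorphisms from
`ΛE` to `A`. -/
abbrev GVar (E : Type*) [AddCommGroup E] [Module ℝ E] : Type _ :=
  ExteriorAlgebra ℝ E →ₐ[ℝ] A

variable {A}

section Linear

variable {E E' : Type*} [AddCommGroup E] [Module ℝ E] [AddCommGroup E'] [Module ℝ E']

/-- The restriction to `E` of a Grassmann random variable. -/
def GVar.restrict (X : GVar A E) : E →ₗ[ℝ] A :=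
  X.toLinearMap ∘ₗ ExteriorAlgebra.ι ℝ

/-- `X` and `Y` are compatible: the linear map `(v, w) ↦ X(v) + Y(w)` on `E ⊕ E'` extends to an
algebra homomorphism on `Λ(E ⊕ E')`. -/
def Compatible (X : GVar A E) (Y : GVar A E') : Prop :=
  ∃ Z : GVar A (E × E'), ∀ v w, Z.restrict (v, w) = X.restrict v + Y.restrict w

/-- (Tensor) independence of compatible `X` and `Y` under `ω`. -/
def Independent (ω : A →L[ℂ] ℂ) (X : GVar A E) (Y : GVar A E') : Prop :=
  Compatible X Y ∧ ∀ F G, ω (X F * Y G) = ω (X F) * ω (Y G)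

/-- `Z`, a Grassmann variable on the direct sum `⨁_{i ∈ ι} E`, is the joint variable of the
(hence compatible) family `X`. -/
def IsJoint {ι : Type*} (X : ι → GVar A E) (Z : GVar A (ι →₀ E)) : Prop :=
  ∀ i v, Z.restrict (Finsupp.single i v) = (X i).restrict v

end Linear

/-! ### Gaussian variables, white noise, Brownian motion -/

/-- `X` is a centered Grassmann Gaussian variable under `ω` with the antisymmetric bounded
correlation `C`. -/
structure IsGaussian {E : Type*} [NormedAddCommGroup E] [InnerProductSpace ℝ E]
    (ω : A →L[ℂ] ℂ) (C : E →L[ℝ] E) (X : GVar A E) : Prop where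
  antisymm : ∀ v w, inner ℝ v (C w) = -inner ℝ (C v) w
  bounded : Continuous X.restrict
  wick : ∀ (G : ExteriorAlgebra ℝ E) (f : E),
    ω (X G * X.restrict f) = ω (X (pair (C f) (rightDeriv E G)))

variable {V : Type*} [NormedAddCommGroup V] [InnerProductSpace ℝ V]

/-- `Ξ` is a `V`-valued one-dimensional white noise with correlation `C`: a Gaussian variable on
`L²(ℝ; V)` whose correlation is the pointwise action of `C`. -/
def IsWhiteNoise (ω : A →L[ℂ] ℂ) (C : V →L[ℝ] V)
    (Ξ : GVar A (Lp V 2 (volume : Measure ℝ))) : Prop :=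
  IsGaussian ω (C.compLpL 2 (volume : Measure ℝ)) Ξ

/-- The element `𝟙_{[0,t]} ⊗ v` of `L²(ℝ; V)`. -/
def indicatorVec (t : ℝ≥0) (v : V) : Lp V 2 (volume : Measure ℝ) :=
  indicatorConstLp 2 (measurableSet_Icc (a := (0 : ℝ)) (b := (t : ℝ))) measure_Icc_lt_top.ne v

/-- `B` is a `V`-valued Brownian motion with correlation `C`, that is `B_t(v) = Ξ(𝟙_{[0,t]} ⊗ v)`
for a white noise `Ξ` with correlation `C`. -/
def IsBrownianMotion (ω : A →L[ℂ] ℂ) (C : V →L[ℝ] V) (B : ℝ≥0 → GVar A V) : Prop :=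
  ∃ Ξ : GVar A (Lp V 2 (volume : Measure ℝ)), IsWhiteNoise ω C Ξ ∧
    ∀ t v, (B t).restrict v = Ξ.restrict (indicatorVec t v)

/-! ### The additive Grassmann stochastic differential equation -/

/-- `X` is compatible with and independent of the process `B` under `ω`: it is so with respect to
the joint variable of the family `(B_t)_{t ≥ 0}`. -/
def IndependentOfProcess {E : Type*} [AddCommGroup E] [Module ℝ E]
    (ω : A →L[ℂ] ℂ) (X : GVar A E) (B : ℝ≥0 → GVar A V) : Prop :=
  ∃ Z : GVar A (ℝ≥0 →₀ V), IsJoint B Z ∧ Independent ω X Z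

/-- The restriction to the finite-dimensional space `V` of a Grassmann random variable, as an
element of the normed space `𝓛(V, A)`. The distance on the Grassmann variables is the operator norm
distance `sup_{‖v‖ = 1} ‖X(v) - Y(v)‖` of these restrictions. -/
def GVar.restrictL [FiniteDimensional ℝ V] (X : GVar A V) : V →L[ℝ] A :=
  LinearMap.toContinuousLinearMap X.restrict

/-- `Ψ : [0, ∞) → Hom(ΛV, A)` is a global solution of the additive SDE
`Ψ_t(v) = Ψ₀(v) + ∫₀ᵗ Ψ_s(F(v)) ds + B_t(v)` with drift `F`, driven by `B` and with initial
condition `Ψ₀`. -/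
structure IsGlobalSolution [FiniteDimensional ℝ V] (F : V →ₗ[ℝ] ExteriorAlgebra ℝ V)
    (B : ℝ≥0 → GVar A V) (Ψ₀ : GVar A V) (Ψ : ℝ≥0 → GVar A V) : Prop where
  continuous : Continuous fun t => (Ψ t).restrictL
  eqn : ∀ (t : ℝ≥0) (v : V),
    (Ψ t).restrict v =
      Ψ₀.restrict v + (∫ s in (0 : ℝ)..t, Ψ s.toNNReal (F v)) + (B t).restrict v

end Probability

end Grassmann

end

open Grassmann

/-! The formula is obtained by computing the right derivative of `ω (Ψ_t(G) Ψ₀(H))` at every time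
`s` and integrating. Independence first combines the initial condition and the noise into one
variable `Y` on `V ⊕ ⨁ V`, for which the Wick rule still holds: multiplying by a noise generator on
the right amounts to contracting with its covariance (`wick_of_independent`).

Since the covariance of `B` is `min r t` times `C`, contraction with an increment after `s` kills
everything built from the initial condition and the noise up to `s`. That `Ψ_s` belongs to this past
is a Grönwall argument in the quotient of `A` by the closed odd past `W`: modulo `W` only the drift
remains, and because `F` is odd its class is bounded by a multiple of the class of `Ψ` itself, so
both vanish (`restrict_mem_of_drift`). The increment `N` therefore anticommutes with `Ψ_s(v)`, and
for `a` in the past `ω (a N(v)) = 0` and `ω (a N(v) N(w)) = (x - s) ⟨v, C w⟩ ω(a)`.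

Finally `Ψ_x = Ψ_s + N + D` on `V`, with `N` of order `√(x - s)` and `D` the drift contribution, of
order `x - s`. Expanding `Ψ_x(G)` up to `o(x - s)` (`isLittleO_expansion`) yields a term linear in
`N`, which `ω` kills, a quadratic one, which gives `½ Q_C(∂_R² G)`, and a drift term `∂_R G · F`. -/

noncomputable section

namespace Grassmann

/-! ### Antiderivations of the Grassmann algebra -/

section Algebra

variable {E E' : Type*} [AddCommGroup E] [Module ℝ E] [AddCommGroup E'] [Module ℝ E']

open CliffordAlgebra (involute contractRight)

theorem ι_mul_eq_involute_mul_ι (m : E) (x : ExteriorAlgebra ℝ E) :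
    ExteriorAlgebra.ι ℝ m * x = involute x * ExteriorAlgebra.ι ℝ m := by
  induction x using CliffordAlgebra.right_induction with
  | algebraMap r => rw [AlgHom.commutes, Algebra.commutes]
  | add x y hx hy => rw [mul_add, hx, hy, map_add, add_mul]
  | mul_ι n x hx =>
    have h := ExteriorAlgebra.ι_add_mul_swap (R := ℝ) m n
    rw [← mul_assoc, hx, mul_assoc, eq_neg_of_add_eq_zero_left h, map_mul,
      CliffordAlgebra.involute_ι, mul_neg, mul_neg, neg_mul, mul_assoc]

theorem ι_mul_eq_neg_mul_ι (m : E) {x : ExteriorAlgebra ℝ E} (hx : x ∈ parity E 1) :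
    ExteriorAlgebra.ι ℝ m * x = -(x * ExteriorAlgebra.ι ℝ m) := by
  rw [ι_mul_eq_involute_mul_ι, CliffordAlgebra.involute_eq_of_mem_odd hx, neg_mul]

theorem contractRight_mul (d : Module.Dual ℝ E) (x y : ExteriorAlgebra ℝ E) :
    contractRight (x * y) d = x * contractRight y d + contractRight x d * involute y := by
  induction y using CliffordAlgebra.right_induction with
  | algebraMap r => simp [CliffordAlgebra.contractRight_mul_algebraMap]
  | add y z hy hz => simp only [mul_add, map_add, LinearMap.add_apply, hy, hz]; abel
  | mul_ι m y hy =>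
    rw [← mul_assoc, CliffordAlgebra.contractRight_mul_ι, CliffordAlgebra.contractRight_mul_ι, hy,
      map_mul, CliffordAlgebra.involute_ι]
    simp only [mul_sub, mul_smul_comm, add_mul, mul_neg, mul_assoc]
    abel

theorem contractRight_map (f : E →ₗ[ℝ] E') (d : Module.Dual ℝ E') (x : ExteriorAlgebra ℝ E) :
    contractRight (ExteriorAlgebra.map f x) d
      = ExteriorAlgebra.map f (contractRight x (d ∘ₗ f)) := by
  induction x using CliffordAlgebra.right_induction with
  | algebraMap r => simp
  | add x y hx hy => simp only [map_add, LinearMap.add_apply, hx, hy]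
  | mul_ι m x hx =>
    have h : ExteriorAlgebra.map f (CliffordAlgebra.ι (0 : QuadraticForm ℝ E) m)
        = ExteriorAlgebra.ι ℝ (f m) := ExteriorAlgebra.map_apply_ι f m
    rw [CliffordAlgebra.contractRight_mul_ι, map_mul, h]
    erw [CliffordAlgebra.contractRight_mul_ι, hx]
    rw [map_sub, map_smul, map_mul, h]
    rfl

/-- The elements of `ΛE` annihilated by the antiderivation of contraction with `d`. -/
def contractKer (d : Module.Dual ℝ E) : Subalgebra ℝ (ExteriorAlgebra ℝ E) where
  carrier := {x | contractRight x d = 0 ∧ contractRight (involute x) d = 0}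
  mul_mem' := by
    rintro x y ⟨hx, hx'⟩ ⟨hy, hy'⟩
    constructor
    · rw [contractRight_mul, hx, hy]; simp
    · rw [map_mul, contractRight_mul, hx', hy']; simp
  add_mem' := by
    rintro x y ⟨hx, hx'⟩ ⟨hy, hy'⟩
    constructor <;> simp only [map_add, LinearMap.add_apply, hx, hy, hx', hy', add_zero]
  algebraMap_mem' r := by simp

theorem ι_mem_contractKer {d : Module.Dual ℝ E} {m : E} (h : d m = 0) :
    ExteriorAlgebra.ι ℝ m ∈ contractKer d := by
  constructor
  · rw [CliffordAlgebra.contractRight_ι, h, map_zero]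
  · rw [CliffordAlgebra.involute_ι, map_neg, LinearMap.neg_apply,
      CliffordAlgebra.contractRight_ι, h, map_zero, neg_zero]

theorem contractRight_mul_ι_of_mem {d : Module.Dual ℝ E} {x : ExteriorAlgebra ℝ E}
    (h : x ∈ contractKer d) (m : E) :
    contractRight (x * ExteriorAlgebra.ι ℝ m) d = d m • x := by
  rw [CliffordAlgebra.contractRight_mul_ι, h.1, zero_mul, sub_zero]

end Algebra

/-! ### The right derivative of a product with a generator -/

section RightDerivative

variable {E : Type*} [AddCommGroup E] [Module ℝ E]

open CliffordAlgebra (involute contractRight)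
open GradedTensorProduct (of)

/-- The Koszul sign for moving the odd `v` past `b` is carried by the grade involution, so `b` need
not be homogeneous. -/
theorem of_tmul_mul_of_ι_tmul_one (a b : ExteriorAlgebra ℝ E) (v : E) :
    of ℝ (parity E) (parity E) (a ⊗ₜ b)
        * of ℝ (parity E) (parity E) (ExteriorAlgebra.ι ℝ v ⊗ₜ 1)
      = of ℝ (parity E) (parity E) ((a * ExteriorAlgebra.ι ℝ v) ⊗ₜ involute b) := by
  have hv := CliffordAlgebra.ι_mem_evenOdd_one (0 : QuadraticForm ℝ E) v
  induction b using DirectSum.Decomposition.inductionOn (parity E) with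
  | zero => simp
  | @homogeneous i b =>
    have h := GradedTensorProduct.tmul_coe_mul_coe_tmul (R := ℝ) (parity E) (parity E) a b
      ⟨_, hv⟩ 1
    refine h.trans ?_
    obtain ⟨b, hb⟩ := b
    have hi : ∀ j : ZMod 2, j = 0 ∨ j = 1 := by decide
    rcases hi i with rfl | rfl
    · rw [zero_mul, uzpow_zero, one_smul, mul_one, CliffordAlgebra.involute_eq_of_mem_even hb]
    · rw [one_mul, uzpow_one, Units.neg_smul, one_smul, mul_one,
        CliffordAlgebra.involute_eq_of_mem_odd hb, TensorProduct.tmul_neg, map_neg]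
  | add b c hb hc => simp only [TensorProduct.tmul_add, map_add, add_mul, hb, hc]

theorem of_tmul_mul_of_one_tmul (a b c : ExteriorAlgebra ℝ E) :
    of ℝ (parity E) (parity E) (a ⊗ₜ b) * of ℝ (parity E) (parity E) (1 ⊗ₜ c)
      = of ℝ (parity E) (parity E) (a ⊗ₜ (b * c)) := by
  induction b using DirectSum.Decomposition.inductionOn (parity E) with
  | zero => simp
  | homogeneous b => exact GradedTensorProduct.tmul_coe_mul_one_tmul (parity E) (parity E) a b c
  | add b d hb hd => simp only [TensorProduct.tmul_add, map_add, add_mul, hb, hd]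

theorem algebraMapInv_ι (v : E) :
    ExteriorAlgebra.algebraMapInv (ExteriorAlgebra.ι ℝ v) = (0 : ℝ) := by
  simp [ExteriorAlgebra.algebraMapInv]

theorem ιInv_mul_ι (b : ExteriorAlgebra ℝ E) (v : E) :
    ExteriorAlgebra.ιInv (b * ExteriorAlgebra.ι ℝ v)
      = ExteriorAlgebra.algebraMapInv b • v := by
  -- `ιInv` is the second component of the map to the trivial square-zero extension; these are the
  -- instances that its definition uses.
  let : Module ℝᵐᵒᵖ E := Module.compHom _ ((RingHom.id ℝ).fromOpposite mul_comm)
  have : IsCentralScalar ℝ E := ⟨fun r m => rfl⟩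
  have hfst : TrivSqZeroExt.fst (ExteriorAlgebra.toTrivSqZeroExt b)
      = ExteriorAlgebra.algebraMapInv b := by
    have : (TrivSqZeroExt.fstHom ℝ ℝ E).comp ExteriorAlgebra.toTrivSqZeroExt
        = ExteriorAlgebra.algebraMapInv := by
      apply ExteriorAlgebra.hom_ext
      ext v
      simp [algebraMapInv_ι]
    exact DFunLike.congr_fun this b
  change TrivSqZeroExt.snd (ExteriorAlgebra.toTrivSqZeroExt (b * ExteriorAlgebra.ι ℝ v)) = _
  rw [map_mul, ExteriorAlgebra.toTrivSqZeroExt_ι]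
  simp [hfst]

theorem ιInv_algebraMap (r : ℝ) :
    ExteriorAlgebra.ιInv (algebraMap ℝ (ExteriorAlgebra ℝ E) r) = 0 := by
  let : Module ℝᵐᵒᵖ E := Module.compHom _ ((RingHom.id ℝ).fromOpposite mul_comm)
  have : IsCentralScalar ℝ E := ⟨fun r m => rfl⟩
  exact (congrArg TrivSqZeroExt.snd (AlgHom.commutes ExteriorAlgebra.toTrivSqZeroExt r)).trans rfl

theorem algebraMapInv_involute (b : ExteriorAlgebra ℝ E) :
    ExteriorAlgebra.algebraMapInv (involute b) = ExteriorAlgebra.algebraMapInv b := by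
  have : ExteriorAlgebra.algebraMapInv.comp (involute (Q := (0 : QuadraticForm ℝ E)))
      = (ExteriorAlgebra.algebraMapInv : ExteriorAlgebra ℝ E →ₐ[ℝ] ℝ) := by
    apply ExteriorAlgebra.hom_ext
    ext v
    simp [algebraMapInv_ι]
  exact DFunLike.congr_fun this b

theorem ιInv_involute (b : ExteriorAlgebra ℝ E) :
    ExteriorAlgebra.ιInv (involute b) = -ExteriorAlgebra.ιInv b := by
  induction b using CliffordAlgebra.right_induction with
  | algebraMap r =>
    rw [AlgHom.commutes]
    erw [ιInv_algebraMap]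
    simp
  | add x y hx hy => simp only [map_add, hx, hy, neg_add]
  | mul_ι v b _ =>
    rw [map_mul, CliffordAlgebra.involute_ι, mul_neg, map_neg]
    erw [ιInv_mul_ι, ιInv_mul_ι]
    rw [algebraMapInv_involute]

variable (E) in
/-- The partial counit `f ⊗ g ↦ ε(g) f` of the super tensor product. -/
def counitRight : SuperTensor E →ₗ[ℝ] ExteriorAlgebra ℝ E :=
  (TensorProduct.rid ℝ (ExteriorAlgebra ℝ E)).toLinearMap
    ∘ₗ LinearMap.lTensor (ExteriorAlgebra ℝ E) ExteriorAlgebra.algebraMapInv.toLinearMap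
    ∘ₗ (of ℝ (parity E) (parity E)).symm.toLinearMap

theorem counitRight_of_tmul (a b : ExteriorAlgebra ℝ E) :
    counitRight E (of ℝ (parity E) (parity E) (a ⊗ₜ b))
      = ExteriorAlgebra.algebraMapInv b • a := by
  simp [counitRight]

theorem coproduct_mul_ι (G : ExteriorAlgebra ℝ E) (v : E) :
    coproduct E (G * ExteriorAlgebra.ι ℝ v) = coproduct E G * primitive v := by
  rw [map_mul]
  congr 1
  exact ExteriorAlgebra.lift_ι_apply ℝ _ _ v

theorem counitRight_mul_primitive (x : SuperTensor E) (v : E) :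
    counitRight E (x * primitive v) = counitRight E x * ExteriorAlgebra.ι ℝ v := by
  obtain ⟨x, rfl⟩ := (of ℝ (parity E) (parity E)).surjective x
  induction x using TensorProduct.induction_on with
  | zero => simp
  | add x y hx hy => simp only [map_add, add_mul, hx, hy]
  | tmul a b =>
    rw [primitive_apply, mul_add, of_tmul_mul_of_ι_tmul_one, of_tmul_mul_of_one_tmul, map_add]
    simp only [counitRight_of_tmul, map_mul, algebraMapInv_ι, algebraMapInv_involute]
    simp

/-- The counit axiom. It identifies the term of the right derivative in which the last generator is
the one removed. -/
theorem counitRight_coproduct (G : ExteriorAlgebra ℝ E) : counitRight E (coproduct E G) = G := by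
  induction G using CliffordAlgebra.right_induction with
  | algebraMap r =>
    rw [AlgHom.commutes, Algebra.algebraMap_eq_smul_one, map_smul, Algebra.algebraMap_eq_smul_one]
    congr 1
    exact (counitRight_of_tmul (E := E) 1 1).trans (by simp)
  | add x y hx hy => simp only [map_add, hx, hy]
  | mul_ι v G hG =>
    erw [coproduct_mul_ι]
    rw [counitRight_mul_primitive, hG]

/-- Right multiplication by `v ∈ E` on the first factor of `ΛE ⊗ E'`. -/
def mulRightι {E : Type*} [AddCommGroup E] [Module ℝ E] (E' : Type*) [AddCommGroup E']
    [Module ℝ E'] (v : E) : ExteriorAlgebra ℝ E ⊗[ℝ] E' →ₗ[ℝ] ExteriorAlgebra ℝ E ⊗[ℝ] E' :=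
  LinearMap.rTensor E' (LinearMap.mulRight ℝ (ExteriorAlgebra.ι ℝ v))

theorem mulRightι_tmul {E' : Type*} [AddCommGroup E'] [Module ℝ E'] (v : E) (w : E')
    (f : ExteriorAlgebra ℝ E) :
    mulRightι E' v (f ⊗ₜ w) = (f * ExteriorAlgebra.ι ℝ v) ⊗ₜ w := by
  simp [mulRightι]

/-- Either `1 ⊗ v` provides the degree one of the second factor, and only the scalar part there of
`x` survives, or `x` provides it and `v ⊗ 1` moves past an odd element, whence the sign. -/
theorem lTensor_ιInv_mul_primitive (x : SuperTensor E) (v : E) :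
    LinearMap.lTensor (ExteriorAlgebra ℝ E) (ExteriorAlgebra.ιInv (R := ℝ) (M := E))
        ((of ℝ (parity E) (parity E)).symm (x * primitive v))
      = counitRight E x ⊗ₜ v
        - mulRightι E v (LinearMap.lTensor (ExteriorAlgebra ℝ E) ExteriorAlgebra.ιInv
          ((of ℝ (parity E) (parity E)).symm x)) := by
  obtain ⟨x, rfl⟩ := (of ℝ (parity E) (parity E)).surjective x
  induction x using TensorProduct.induction_on with
  | zero => simp
  | add x y hx hy =>
    rw [map_add, add_mul, map_add, map_add, hx, hy]
    simp only [map_add, TensorProduct.add_tmul]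
    abel
  | tmul a b =>
    rw [primitive_apply, mul_add, of_tmul_mul_of_ι_tmul_one, of_tmul_mul_of_one_tmul,
      counitRight_of_tmul]
    simp only [map_add, GradedTensorProduct.of_symm_of, LinearMap.lTensor_tmul, ιInv_involute,
      ιInv_mul_ι, mulRightι_tmul, TensorProduct.tmul_neg, TensorProduct.tmul_smul,
      TensorProduct.smul_tmul']
    abel

/-- The recursion behind every later induction about `∂_R`; the coproduct itself is not needed
afterwards. -/
theorem rightDeriv_mul_ι (G : ExteriorAlgebra ℝ E) (v : E) :
    rightDeriv E (G * ExteriorAlgebra.ι ℝ v) = G ⊗ₜ v - mulRightι E v (rightDeriv E G) := by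
  simp only [rightDeriv, LinearMap.comp_apply, AlgHom.toLinearMap_apply, LinearEquiv.coe_coe]
  rw [coproduct_mul_ι, lTensor_ιInv_mul_primitive, counitRight_coproduct]

theorem rightDeriv_algebraMap (r : ℝ) :
    rightDeriv E (algebraMap ℝ (ExteriorAlgebra ℝ E) r) = 0 := by
  rw [Algebra.algebraMap_eq_smul_one, map_smul]
  simp only [rightDeriv, LinearMap.comp_apply, AlgHom.toLinearMap_apply, LinearEquiv.coe_coe,
    map_one, GradedTensorProduct.of_symm_one, Algebra.TensorProduct.one_def,
    LinearMap.lTensor_tmul]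
  have h : ExteriorAlgebra.ιInv (1 : ExteriorAlgebra ℝ E) = 0 := by
    rw [← map_one (algebraMap ℝ (ExteriorAlgebra ℝ E)), ιInv_algebraMap]
  rw [h]
  simp

theorem dot_tmul (F : E →ₗ[ℝ] ExteriorAlgebra ℝ E) (f : ExteriorAlgebra ℝ E) (v : E) :
    dot F (f ⊗ₜ v) = f * F v := by
  simp [dot]

/-- As `F w` is odd, this sign cancels the one in `rightDeriv_mul_ι`, and `G ↦ ∂_R G · F` obeys the
unsigned Leibniz rule. -/
theorem dot_mulRightι {F : E →ₗ[ℝ] ExteriorAlgebra ℝ E} (hF : ∀ v, F v ∈ parity E 1) (v : E)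
    (K : ExteriorAlgebra ℝ E ⊗[ℝ] E) :
    dot F (mulRightι E v K) = -(dot F K * ExteriorAlgebra.ι ℝ v) := by
  induction K using TensorProduct.induction_on with
  | zero => simp
  | add x y hx hy => simp only [map_add, add_mul, hx, hy, neg_add]
  | tmul f w =>
    rw [mulRightι_tmul, dot_tmul, dot_tmul, mul_assoc, ι_mul_eq_neg_mul_ι v (hF w), mul_neg,
      mul_assoc]

theorem rightDeriv₂_mul_ι (G : ExteriorAlgebra ℝ E) (v : E) :
    rightDeriv₂ E (G * ExteriorAlgebra.ι ℝ v)
      = rightDeriv E G ⊗ₜ v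
        - LinearMap.rTensor E (rightDeriv E) (mulRightι E v (rightDeriv E G)) := by
  rw [rightDeriv₂, LinearMap.comp_apply, rightDeriv_mul_ι, map_sub, LinearMap.rTensor_tmul]

end RightDerivative

section Pairing

variable {E : Type*} [NormedAddCommGroup E] [InnerProductSpace ℝ E]

/-- Puts the Wick rule in terms of contractions, where a graded Leibniz rule and naturality under
`ExteriorAlgebra.map` are at hand. -/
theorem pair_rightDeriv (w : E) (G : ExteriorAlgebra ℝ E) :
    pair w (rightDeriv E G) = CliffordAlgebra.contractRight G (innerₗ E w) := by
  have hK (v : E) (K : ExteriorAlgebra ℝ E ⊗[ℝ] E) :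
      pair w (mulRightι E v K) = pair w K * ExteriorAlgebra.ι ℝ v := by
    induction K using TensorProduct.induction_on with
    | zero => simp
    | add x y hx hy => simp only [map_add, add_mul, hx, hy]
    | tmul f u => rw [mulRightι_tmul, pair_tmul, pair_tmul, smul_mul_assoc]
  induction G using CliffordAlgebra.right_induction with
  | algebraMap r =>
    erw [rightDeriv_algebraMap]
    simp
  | add x y hx hy => simp only [map_add, LinearMap.add_apply, hx, hy]
  | mul_ι v G hG =>
    erw [rightDeriv_mul_ι]
    rw [map_sub, hK, hG, CliffordAlgebra.contractRight_mul_ι, pair_tmul, innerₗ_apply_apply,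
      real_inner_comm]

end Pairing

/-! ### The Grassmann algebra of a product -/

section Product

variable {E E' : Type*} [AddCommGroup E] [Module ℝ E] [AddCommGroup E'] [Module ℝ E']

theorem map_involute (f : E →ₗ[ℝ] E') (x : ExteriorAlgebra ℝ E) :
    ExteriorAlgebra.map f (CliffordAlgebra.involute x)
      = CliffordAlgebra.involute (ExteriorAlgebra.map f x) := by
  have h : (ExteriorAlgebra.map f).comp (CliffordAlgebra.involute (Q := (0 : QuadraticForm ℝ E)))
      = (CliffordAlgebra.involute (Q := (0 : QuadraticForm ℝ E'))).comp
        (ExteriorAlgebra.map f) := by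
    apply ExteriorAlgebra.hom_ext
    ext v
    simp
  exact DFunLike.congr_fun h x

theorem ι_prod (m : E × E') :
    ExteriorAlgebra.ι ℝ m
      = ExteriorAlgebra.map (LinearMap.inl ℝ E E') (ExteriorAlgebra.ι ℝ m.1)
        + ExteriorAlgebra.map (LinearMap.inr ℝ E E') (ExteriorAlgebra.ι ℝ m.2) := by
  rw [ExteriorAlgebra.map_apply_ι, ExteriorAlgebra.map_apply_ι, ← map_add]
  simp

theorem map_inl_mul_map_inr_mul_ι (a : ExteriorAlgebra ℝ E) (b : ExteriorAlgebra ℝ E')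
    (m : E × E') :
    ExteriorAlgebra.map (LinearMap.inl ℝ E E') a * ExteriorAlgebra.map (LinearMap.inr ℝ E E') b
        * ExteriorAlgebra.ι ℝ m
      = ExteriorAlgebra.map (LinearMap.inl ℝ E E') (a * ExteriorAlgebra.ι ℝ m.1)
          * ExteriorAlgebra.map (LinearMap.inr ℝ E E') (CliffordAlgebra.involute b)
        + ExteriorAlgebra.map (LinearMap.inl ℝ E E') a
          * ExteriorAlgebra.map (LinearMap.inr ℝ E E') (b * ExteriorAlgebra.ι ℝ m.2) := by
  rw [ι_prod, mul_add, map_mul, map_mul, map_involute, mul_assoc, mul_assoc, mul_assoc,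
    ExteriorAlgebra.map_apply_ι (LinearMap.inl ℝ E E'), ι_mul_eq_involute_mul_ι,
    CliffordAlgebra.involute_involute]

/-- The additive span of the products `a b` is stable under right multiplication by a generator,
once the `E`-component of the generator is moved past `b`. -/
theorem exteriorAlgebra_prod_induction {P : ExteriorAlgebra ℝ (E × E') → Prop}
    (mul : ∀ (a : ExteriorAlgebra ℝ E) (b : ExteriorAlgebra ℝ E'),
      P (ExteriorAlgebra.map (LinearMap.inl ℝ E E') a
        * ExteriorAlgebra.map (LinearMap.inr ℝ E E') b))
    (add : ∀ x y, P x → P y → P (x + y)) (x : ExteriorAlgebra ℝ (E × E')) : P x := by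
  let S : Set (ExteriorAlgebra ℝ (E × E')) :=
    {x | ∃ a b, x = ExteriorAlgebra.map (LinearMap.inl ℝ E E') a
      * ExteriorAlgebra.map (LinearMap.inr ℝ E E') b}
  have hS : x ∈ AddSubmonoid.closure S := by
    induction x using CliffordAlgebra.right_induction with
    | algebraMap r =>
      refine AddSubmonoid.subset_closure ⟨algebraMap ℝ _ r, 1, ?_⟩
      rw [AlgHom.commutes, map_one, mul_one]
    | add x y hx hy => exact add_mem hx hy
    | mul_ι m x hx =>
      induction hx using AddSubmonoid.closure_induction with
      | mem x hx =>
        obtain ⟨a, b, rfl⟩ := hx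
        have h := map_inl_mul_map_inr_mul_ι a b m
        exact h ▸ add_mem (AddSubmonoid.subset_closure ⟨_, _, rfl⟩)
          (AddSubmonoid.subset_closure ⟨_, _, rfl⟩)
      | zero => rw [zero_mul]; exact zero_mem _
      | add x y _ _ hx hy => rw [add_mul]; exact add_mem hx hy
  induction hS using AddSubmonoid.closure_induction with
  | mem x hx => obtain ⟨a, b, rfl⟩ := hx; exact mul a b
  | zero => simpa using mul 0 0
  | add x y _ _ hx hy => exact add _ _ hx hy

theorem contractRight_eq_zero_of_comp_eq_zero (f : E →ₗ[ℝ] E') (d : Module.Dual ℝ E')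
    (h : d ∘ₗ f = 0) (x : ExteriorAlgebra ℝ E) :
    CliffordAlgebra.contractRight (ExteriorAlgebra.map f x) d = 0 := by
  rw [contractRight_map, h, map_zero, map_zero]

end Product

/-! ### Indicators in `L²` -/

section Indicator

theorem indicatorVec_coeFn {V : Type*} [NormedAddCommGroup V] (t : ℝ≥0) (v : V) :
    indicatorVec t v =ᵐ[volume] (Set.Icc (0 : ℝ) t).indicator fun _ => v :=
  indicatorConstLp_coeFn

variable {V : Type*} [NormedAddCommGroup V] [InnerProductSpace ℝ V]

theorem inner_indicatorVec [CompleteSpace V] (r t : ℝ≥0) (v w : V) :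
    inner ℝ (indicatorVec r v) (indicatorVec t w) = ((min r t : ℝ≥0) : ℝ) * inner ℝ v w := by
  rw [indicatorVec, indicatorVec, L2.inner_indicatorConstLp_indicatorConstLp _ _
    measure_Icc_lt_top.ne measure_Icc_lt_top.ne, Set.Icc_inter_Icc, smul_eq_mul, max_self]
  congr 1
  rw [Real.volume_real_Icc]
  simp

theorem compLpL_indicatorVec (C : V →L[ℝ] V) (t : ℝ≥0) (v : V) :
    C.compLpL 2 (volume : Measure ℝ) (indicatorVec t v) = indicatorVec t (C v) := by
  ext1
  refine (C.coeFn_compLpL _).trans ?_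
  filter_upwards [indicatorVec_coeFn t v, indicatorVec_coeFn t (C v)] with x hx hx'
  rw [hx, hx']
  by_cases h : x ∈ Set.Icc (0 : ℝ) t <;> simp [h]

/-- The map `v ↦ 𝟙_{[0,t]} ⊗ v`, as a linear map. -/
def indicatorVecₗ (t : ℝ≥0) : V →ₗ[ℝ] Lp V 2 (volume : Measure ℝ) where
  toFun := indicatorVec t
  map_add' v w := by
    ext1
    refine .trans ?_ (Lp.coeFn_add _ _).symm
    filter_upwards [indicatorVec_coeFn t v, indicatorVec_coeFn t w,
      indicatorVec_coeFn t (v + w)] with x h₁ h₂ h₃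
    rw [Pi.add_apply, h₁, h₂, h₃]
    by_cases h : x ∈ Set.Icc (0 : ℝ) t <;> simp [h]
  map_smul' c v := by
    ext1
    refine .trans ?_ (Lp.coeFn_smul _ _).symm
    filter_upwards [indicatorVec_coeFn t v, indicatorVec_coeFn t (c • v)] with x h₁ h₂
    rw [RingHom.id_apply, Pi.smul_apply, h₁, h₂]
    by_cases h : x ∈ Set.Icc (0 : ℝ) t <;> simp [h]

variable (V) in
/-- The linear map `⨁_{t ≥ 0} V → L²(ℝ; V)` equal to `v ↦ 𝟙_{[0,t]} ⊗ v` on the summand `t`. -/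
def indicatorSum : (ℝ≥0 →₀ V) →ₗ[ℝ] Lp V 2 (volume : Measure ℝ) :=
  Finsupp.lsum ℝ indicatorVecₗ

@[simp]
theorem indicatorSum_single (t : ℝ≥0) (v : V) :
    indicatorSum V (Finsupp.single t v) = indicatorVec t v := by
  simp [indicatorSum]
  rfl

/-- The element of `⨁_{t ≥ 0} V` which stands for the increment of a process over `[s, t]`. -/
def incr (s t : ℝ≥0) : V →ₗ[ℝ] (ℝ≥0 →₀ V) :=
  Finsupp.lsingle t - Finsupp.lsingle s

theorem indicatorSum_incr (s t : ℝ≥0) (v : V) :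
    indicatorSum V (incr s t v) = indicatorVec t v - indicatorVec s v := by
  simp [incr]

theorem norm_indicatorSum_incr [CompleteSpace V] {s t : ℝ≥0} (h : s ≤ t) (v : V) :
    ‖indicatorSum V (incr s t v)‖ = √((t : ℝ) - s) * ‖v‖ := by
  rw [← sq_eq_sq₀ (norm_nonneg _) (by positivity), mul_pow,
    Real.sq_sqrt (sub_nonneg.2 (NNReal.coe_le_coe.2 h)), indicatorSum_incr,
    ← real_inner_self_eq_norm_sq, ← real_inner_self_eq_norm_sq]
  simp only [inner_sub_left, inner_sub_right, inner_indicatorVec, min_eq_left h, min_eq_right h,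
    min_self]
  ring

end Indicator

/-! ### The joint law of the initial condition and the noise -/

section Joint

variable {A : Type*} [NormedRing A] [NormedAlgebra ℂ A]
variable {V : Type*} [NormedAddCommGroup V] [InnerProductSpace ℝ V]
variable {E : Type*} [AddCommGroup E] [Module ℝ E]

/-- The functional `m ↦ ⟨m, C n⟩` on `E ⊕ ⨁_{t ≥ 0} V` given by the correlation of the noise. -/
def covariance (E : Type*) [AddCommGroup E] [Module ℝ E] (C : V →L[ℝ] V) (n : ℝ≥0 →₀ V) :
    Module.Dual ℝ (E × (ℝ≥0 →₀ V)) :=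
  innerₗ _ (C.compLpL 2 (volume : Measure ℝ) (indicatorSum V n)) ∘ₗ indicatorSum V
    ∘ₗ LinearMap.snd ℝ E (ℝ≥0 →₀ V)

theorem covariance_apply (C : V →L[ℝ] V) (n m : ℝ≥0 →₀ V) (e : E) :
    covariance E C n (e, m)
      = inner ℝ (indicatorSum V m) (C.compLpL 2 (volume : Measure ℝ) (indicatorSum V n)) := by
  simp [covariance, real_inner_comm]

theorem covariance_incr_single [CompleteSpace V] (C : V →L[ℝ] V) {r s t : ℝ≥0} (hr : r ≤ s)
    (h : s ≤ t) (v w : V) (e : E) : covariance E C (incr s t w) (e, Finsupp.single r v) = 0 := by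
  rw [covariance_apply, indicatorSum_incr, map_sub, compLpL_indicatorVec, compLpL_indicatorVec,
    indicatorSum_single, inner_sub_right, inner_indicatorVec, inner_indicatorVec, min_eq_left hr,
    min_eq_left (hr.trans h), sub_self]

theorem covariance_incr_incr [CompleteSpace V] (C : V →L[ℝ] V) {s t : ℝ≥0}
    (h : s ≤ t) (v w : V) (e : E) :
    covariance E C (incr s t w) (e, incr s t v) = ((t : ℝ) - s) * inner ℝ v (C w) := by
  rw [covariance_apply, indicatorSum_incr, indicatorSum_incr, map_sub, compLpL_indicatorVec,
    compLpL_indicatorVec]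
  simp only [inner_sub_left, inner_sub_right, inner_indicatorVec, min_eq_left h, min_eq_right h,
    min_self]
  ring

/-- On a product `a b` the contraction sees only the noise factor `b`. Independence splits off `X a`
on both sides, and what remains is the Wick rule of `Ξ`. -/
theorem wick_of_independent {ω : A →L[ℂ] ℂ} {C : V →L[ℝ] V}
    {Ξ : GVar A (Lp V 2 (volume : Measure ℝ))} (hΞ : IsWhiteNoise ω C Ξ) {X : GVar A E}
    (hX : ∀ P Q, ω (X P * Ξ (ExteriorAlgebra.map (indicatorSum V) Q))
      = ω (X P) * ω (Ξ (ExteriorAlgebra.map (indicatorSum V) Q)))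
    {Y : GVar A (E × (ℝ≥0 →₀ V))}
    (hY : ∀ v w, Y.restrict (v, w) = X.restrict v + Ξ.restrict (indicatorSum V w))
    (p : ExteriorAlgebra ℝ (E × (ℝ≥0 →₀ V))) (n : ℝ≥0 →₀ V) :
    ω (Y p * Y.restrict (0, n))
      = ω (Y (CliffordAlgebra.contractRight p (covariance E C n))) := by
  have hl : Y.comp (ExteriorAlgebra.map (LinearMap.inl ℝ E (ℝ≥0 →₀ V))) = X := by
    apply ExteriorAlgebra.hom_ext
    ext v
    have := hY v 0
    rw [map_zero, map_zero, add_zero] at this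
    simpa [GVar.restrict] using this
  have hr : Y.comp (ExteriorAlgebra.map (LinearMap.inr ℝ E (ℝ≥0 →₀ V)))
      = Ξ.comp (ExteriorAlgebra.map (indicatorSum V)) := by
    apply ExteriorAlgebra.hom_ext
    refine LinearMap.ext fun w => ?_
    have := hY 0 w
    rw [map_zero, zero_add] at this
    simpa [GVar.restrict] using this
  have hl' (a) : Y (ExteriorAlgebra.map (LinearMap.inl ℝ E (ℝ≥0 →₀ V)) a) = X a :=
    DFunLike.congr_fun hl a
  have hr' (b) : Y (ExteriorAlgebra.map (LinearMap.inr ℝ E (ℝ≥0 →₀ V)) b)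
      = Ξ (ExteriorAlgebra.map (indicatorSum V) b) := DFunLike.congr_fun hr b
  induction p using exteriorAlgebra_prod_induction with
  | add x y hx hy => simp only [map_add, add_mul, LinearMap.add_apply, hx, hy]
  | mul a b =>
    have hn : Y.restrict (0, n) = Ξ.restrict (indicatorSum V n) := by
      rw [hY, map_zero, zero_add]
    have hn' : Ξ.restrict (indicatorSum V n)
        = Ξ (ExteriorAlgebra.map (indicatorSum V) (ExteriorAlgebra.ι ℝ n)) := by
      simp [GVar.restrict]
    have h0 : covariance E C n ∘ₗ LinearMap.inl ℝ E (ℝ≥0 →₀ V) = 0 := by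
      ext v
      simp [covariance]
    have h1 : covariance E C n ∘ₗ LinearMap.inr ℝ E (ℝ≥0 →₀ V)
        = innerₗ _ (C.compLpL 2 (volume : Measure ℝ) (indicatorSum V n)) ∘ₗ indicatorSum V := by
      exact LinearMap.ext fun w => rfl
    rw [contractRight_mul, contractRight_eq_zero_of_comp_eq_zero _ _ h0, zero_mul, add_zero,
      contractRight_map, h1, map_mul Y, map_mul Y, hl', hr', hr', ← contractRight_map,
      ← pair_rightDeriv, hn, mul_assoc]
    have hw := hΞ.wick (ExteriorAlgebra.map (indicatorSum V) b) (indicatorSum V n)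
    have h2 : Ξ (ExteriorAlgebra.map (indicatorSum V) b) * Ξ.restrict (indicatorSum V n)
        = Ξ (ExteriorAlgebra.map (indicatorSum V) (b * ExteriorAlgebra.ι ℝ n)) := by
      rw [map_mul, map_mul, ← hn']
    rw [h2, hX, ← h2, hw, pair_rightDeriv, contractRight_map, hX]

end Joint

/-! ### Invariance of closed subspaces under the drift -/

section Invariance

theorem norm_mul_sub_mul_le {A : Type*} [NormedRing A] {a b c d : A} {K L η : ℝ} (ha : ‖a‖ ≤ K) (hd : ‖d‖ ≤ L)
    {K' L' : ℝ} (hac : ‖a - c‖ ≤ K' * η) (hbd : ‖b - d‖ ≤ L' * η) :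
    ‖a * b - c * d‖ ≤ (K * L' + K' * L) * η := by
  have h : a * b - c * d = a * (b - d) + (a - c) * d := by noncomm_ring
  rw [h]
  calc _ ≤ ‖a‖ * ‖b - d‖ + ‖a - c‖ * ‖d‖ :=
        (norm_add_le _ _).trans (add_le_add (norm_mul_le _ _) (norm_mul_le _ _))
    _ ≤ K * (L' * η) + K' * η * L := by
        have := (norm_nonneg a).trans ha
        have := norm_nonneg d
        have := (norm_nonneg (a - c)).trans hac
        gcongr
    _ = _ := by ring

variable {A : Type*} [NormedRing A] [NormedAlgebra ℂ A]
variable {V : Type*} [NormedAddCommGroup V] [InnerProductSpace ℝ V]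
variable {κ : Type*} [Fintype κ]

theorem exists_approx_ι (W : Submodule ℝ A) (b : Module.Basis κ ℝ V) (R : ℝ) (v : V) :
    ∃ L : ℝ, 0 ≤ L ∧ ∀ (X : GVar A V) (w : κ → A), (∀ i, w i ∈ W) → (∀ i, ‖X.restrict (b i)‖ ≤ R) →
      (∀ i, ‖w i‖ ≤ R) → ∀ η : ℝ, 0 ≤ η → (∀ i, ‖X.restrict (b i) - w i‖ ≤ η) →
      ∃ q ∈ W, ‖q‖ ≤ L ∧ ‖X (ExteriorAlgebra.ι ℝ v)‖ ≤ L ∧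
        ‖X (ExteriorAlgebra.ι ℝ v) - q‖ ≤ L * η := by
  set c : ℝ := ∑ i, ‖b.repr v i‖ with hc
  have hc0 : 0 ≤ c := Finset.sum_nonneg fun i _ => norm_nonneg _
  -- `c` is the ℓ¹ norm of the coordinates of `v`; `|R| + 1` dominates both `R`, for the size
  -- bounds, and `1`, for the coefficient of `η`.
  refine ⟨c * (|R| + 1), by positivity, fun X w hw hX hwR η hη hXw => ?_⟩
  have hXv : X (ExteriorAlgebra.ι ℝ v) = ∑ i, b.repr v i • X.restrict (b i) := by
    change X.restrict v = _
    conv_lhs => rw [← b.sum_repr v, map_sum]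
    simp only [map_smul]
  have hsum (y : κ → A) (K : ℝ) (hy : ∀ i, ‖y i‖ ≤ K) : ‖∑ i, b.repr v i • y i‖ ≤ c * K := by
    rw [hc, Finset.sum_mul]
    refine norm_sum_le_of_le _ fun i _ => ?_
    rw [norm_smul]
    exact mul_le_mul_of_nonneg_left (hy i) (norm_nonneg _)
  have hR : R ≤ |R| + 1 := (le_abs_self R).trans (by simp)
  refine ⟨∑ i, b.repr v i • w i, W.sum_mem fun i _ => W.smul_mem _ (hw i),
    hsum _ _ fun i => (hwR i).trans hR, hXv ▸ hsum _ _ fun i => (hX i).trans hR, ?_⟩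
  rw [hXv, ← Finset.sum_sub_distrib]
  simp only [← smul_sub]
  refine (hsum _ _ hXw).trans ?_
  rw [mul_assoc]
  refine mul_le_mul_of_nonneg_left ?_ hc0
  nlinarith [abs_nonneg R]

/-- The element `q` is the odd polynomial `p` with `w i` substituted for `X (b i)`. The `w i` need
not anticommute, so no homomorphism evaluates `p` at them, and `q` is built along with `p`. The
constant must not depend on `X`. -/
theorem exists_approx_of_odd {W : Submodule ℝ A}
    (hW : ∀ x ∈ W, ∀ y ∈ W, ∀ z ∈ W, x * y * z ∈ W) (b : Module.Basis κ ℝ V) (R : ℝ)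
    {p : ExteriorAlgebra ℝ V} (hp : p ∈ parity V 1) :
    ∃ L : ℝ, 0 ≤ L ∧ ∀ (X : GVar A V) (w : κ → A), (∀ i, w i ∈ W) → (∀ i, ‖X.restrict (b i)‖ ≤ R) →
      (∀ i, ‖w i‖ ≤ R) → ∀ η : ℝ, 0 ≤ η → (∀ i, ‖X.restrict (b i) - w i‖ ≤ η) →
      ∃ q ∈ W, ‖q‖ ≤ L ∧ ‖X p‖ ≤ L ∧ ‖X p - q‖ ≤ L * η := by
  induction p, hp using CliffordAlgebra.odd_induction with
  | ι v => exact exists_approx_ι W b R v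
  | add x y _ _ hx hy =>
    obtain ⟨L, hL, hx⟩ := hx
    obtain ⟨K, hK, hy⟩ := hy
    refine ⟨L + K, by positivity, fun X w hw hX hwR η hη hXw => ?_⟩
    obtain ⟨q, hq, hq₁, hq₂, hq₃⟩ := hx X w hw hX hwR η hη hXw
    obtain ⟨r, hr, hr₁, hr₂, hr₃⟩ := hy X w hw hX hwR η hη hXw
    refine ⟨q + r, W.add_mem hq hr, norm_add_le_of_le hq₁ hr₁, ?_, ?_⟩
    · rw [map_add]
      exact norm_add_le_of_le hq₂ hr₂
    · rw [map_add, add_sub_add_comm, add_mul]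
      exact norm_add_le_of_le hq₃ hr₃
  | ι_mul_ι_mul m n x _ hx =>
    obtain ⟨L, hL, hm⟩ := exists_approx_ι W b R m
    obtain ⟨K, hK, hn⟩ := exists_approx_ι W b R n
    obtain ⟨N, hN, hx⟩ := hx
    -- Replacing the three factors one at a time costs `L * K * N * η` each.
    refine ⟨3 * (L * K * N), by positivity, fun X w hw hX hwR η hη hXw => ?_⟩
    obtain ⟨q, hq, hq₁, hq₂, hq₃⟩ := hm X w hw hX hwR η hη hXw
    obtain ⟨r, hr, hr₁, hr₂, hr₃⟩ := hn X w hw hX hwR η hη hXw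
    obtain ⟨s, hs, hs₁, hs₂, hs₃⟩ := hx X w hw hX hwR η hη hXw
    have h3 {x y z : A} (hx : ‖x‖ ≤ L) (hy : ‖y‖ ≤ K) (hz : ‖z‖ ≤ N) :
        ‖x * y * z‖ ≤ 3 * (L * K * N) := by
      have : ‖x * y * z‖ ≤ L * K * N :=
        norm_mul_le_of_le (norm_mul_le_of_le hx hy) hz
      have : 0 ≤ L * K * N := by positivity
      linarith
    refine ⟨q * r * s, hW q hq r hr s hs, h3 hq₁ hr₁ hs₁, ?_, ?_⟩
    · rw [map_mul, map_mul]
      exact h3 hq₂ hr₂ hs₂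
    · rw [map_mul, map_mul]
      refine (norm_mul_sub_mul_le (norm_mul_le_of_le hq₂ hr₂) hs₁
        (norm_mul_sub_mul_le hq₂ hr₁ hq₃ hr₃) hs₃).trans_eq ?_
      ring

/-- Subtracting from `X (b i)` a nearly minimal representative `m i` of its class gives elements of
`W` at distance at most `u + ε`; then `ε` tends to zero. -/
theorem exists_norm_mk_le_of_odd {W : Submodule ℝ A}
    (hW : ∀ x ∈ W, ∀ y ∈ W, ∀ z ∈ W, x * y * z ∈ W) (b : Module.Basis κ ℝ V) (R : ℝ)
    {p : ExteriorAlgebra ℝ V} (hp : p ∈ parity V 1) :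
    ∃ L : ℝ, 0 ≤ L ∧ ∀ X : GVar A V, (∀ i, ‖X.restrict (b i)‖ ≤ R) →
      ‖W.mkQ (X p)‖ ≤ L * ‖fun i => W.mkQ (X.restrict (b i))‖ := by
  -- The bound covers `‖X (b i) - m i‖ ≤ |R| + (|R| + 1)`, where `ε ≤ 1` is used.
  obtain ⟨L, hL, h⟩ := exists_approx_of_odd hW b (2 * |R| + 1) hp
  refine ⟨L, hL, fun X hX => ?_⟩
  set u := ‖fun i => W.mkQ (X.restrict (b i))‖ with hu
  have key : ∀ ε ∈ Set.Ioc (0 : ℝ) 1, ‖W.mkQ (X p)‖ ≤ L * (u + ε) := by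
    intro ε hε
    choose m hm hm' using fun i => Submodule.Quotient.norm_mk_lt (W.mkQ (X.restrict (b i))) hε.1
    have hmu (i) : ‖m i‖ ≤ u + ε :=
      (hm' i).le.trans (add_le_add_left (norm_le_pi_norm (fun i => W.mkQ (X.restrict (b i))) i) _)
    have hXR (i) : ‖X.restrict (b i)‖ ≤ |R| := (hX i).trans (le_abs_self R)
    have hmR (i) : ‖m i‖ ≤ |R| + 1 :=
      (hm' i).le.trans (add_le_add ((Submodule.Quotient.norm_mk_le W _).trans (hXR i)) hε.2)
    obtain ⟨q, hq, -, -, hq'⟩ := h X (fun i => X.restrict (b i) - m i)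
      (fun i => by
        rw [← Submodule.Quotient.mk_eq_zero, Submodule.Quotient.mk_sub, hm, sub_eq_zero]
        rfl)
      (fun i => (hXR i).trans (by linarith [abs_nonneg R]))
      (fun i => (norm_sub_le_of_le (hXR i) (hmR i)).trans (by linarith))
      (u + ε) (add_nonneg (norm_nonneg _) hε.1.le) (fun i => by simpa using hmu i)
    refine le_trans ?_ hq'
    have : W.mkQ (X p) = Submodule.Quotient.mk (X p - q) := by
      rw [Submodule.Quotient.mk_sub, (Submodule.Quotient.mk_eq_zero W).2 hq, sub_zero]
      rfl
    rw [this]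
    exact Submodule.Quotient.norm_mk_le W _
  have hlim : Filter.Tendsto (fun ε : ℝ => L * (u + ε)) (nhdsWithin 0 (Set.Ioi 0))
      (nhds (L * (u + 0))) :=
    Filter.Tendsto.mono_left (Continuous.tendsto (by fun_prop) 0) nhdsWithin_le_nhds
  rw [add_zero] at hlim
  exact ge_of_tendsto hlim (Filter.mem_of_superset (Ioc_mem_nhdsGT one_pos) key)

variable [FiniteDimensional ℝ V]

theorem continuous_apply_of_restrictL {T : Type*} [TopologicalSpace T] {Ψ : T → GVar A V}
    (hΨ : Continuous fun t => (Ψ t).restrictL) (G : ExteriorAlgebra ℝ V) :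
    Continuous fun t => Ψ t G := by
  induction G using CliffordAlgebra.right_induction with
  | algebraMap r => simpa only [AlgHom.commutes] using continuous_const
  | add x y hx hy => simp only [map_add]; exact hx.add hy
  | mul_ι v x hx =>
    have hv : Continuous fun t => (Ψ t).restrictL v := hΨ.clm_apply continuous_const
    simp only [map_mul]
    exact hx.mul hv

/-- Modulo `W` the solution equals its drift integral `f`, so `‖f'‖ ≤ const * ‖f‖` with `f 0 = 0`,
and Grönwall gives `f = 0`. Closedness of `W` makes the quotient seminorm a norm. -/
theorem restrict_mem_of_drift [CompleteSpace A] {W : Submodule ℝ A}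
    (hWc : IsClosed (W : Set A))
    (hW : ∀ x ∈ W, ∀ y ∈ W, ∀ z ∈ W, x * y * z ∈ W)
    {F : V →ₗ[ℝ] ExteriorAlgebra ℝ V} (hF : ∀ v, F v ∈ parity V 1)
    {Ψ : ℝ≥0 → GVar A V} (hΨ : Continuous fun t => (Ψ t).restrictL) {T : ℝ≥0}
    (h : ∀ s ≤ T, ∀ v, (Ψ s).restrict v - ∫ r in (0 : ℝ)..s, Ψ r.toNNReal (F v) ∈ W)
    {s : ℝ≥0} (hs : s ≤ T) (v : V) : (Ψ s).restrict v ∈ W := by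
  let b := Module.finBasis ℝ V
  have hcont (G : ExteriorAlgebra ℝ V) : Continuous fun r : ℝ => Ψ r.toNNReal G :=
    (continuous_apply_of_restrictL hΨ G).comp continuous_real_toNNReal
  -- The Lipschitz constant of the polynomial drift depends on the size of `Ψ`, hence the uniform
  -- bound on the compact interval.
  obtain ⟨R, hR⟩ : ∃ R : ℝ, ∀ r ∈ Set.Icc (0 : ℝ≥0) T, ‖(Ψ r).restrictL‖ ≤ R :=
    isCompact_Icc.exists_bound_of_continuousOn hΨ.continuousOn
  have hRb (r : ℝ≥0) (hr : r ≤ T) (i) : ‖(Ψ r).restrict (b i)‖ ≤ R * ∑ j, ‖b j‖ := by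
    refine ((Ψ r).restrictL.le_opNorm (b i)).trans ?_
    have := hR r ⟨zero_le, hr⟩
    have h0 := (norm_nonneg _).trans this
    have : ‖b i‖ ≤ ∑ j, ‖b j‖ :=
      Finset.single_le_sum (f := fun j => ‖b j‖) (fun j _ => norm_nonneg _) (Finset.mem_univ i)
    gcongr
  choose L hL hLb using fun i =>
    exists_norm_mk_le_of_odd hW b (R * ∑ j, ‖b j‖) (hF (b i))
  let π : A →L[ℝ] A ⧸ W := W.mkQ.mkContinuous 1 fun x => by
    rw [one_mul]
    exact Submodule.Quotient.norm_mk_le W x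
  let f : ℝ → (Fin (Module.finrank ℝ V) → A ⧸ W) :=
    fun x i => π (∫ r in (0 : ℝ)..x, Ψ r.toNNReal (F (b i)))
  let f' : ℝ → (Fin (Module.finrank ℝ V) → A ⧸ W) := fun x i => π (Ψ x.toNNReal (F (b i)))
  have hf : ∀ x, HasDerivAt f (f' x) x := fun x => hasDerivAt_pi.2 fun i =>
    π.hasFDerivAt.comp_hasDerivAt x
      (((hcont (F (b i))).integral_hasStrictDerivAt 0 x).hasDerivAt)
  have hf0 : f 0 = 0 := by
    ext i
    simp [f]
  have hfΨ (x : ℝ) (hx : x ∈ Set.Icc (0 : ℝ) T) :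
      f x = fun i => W.mkQ ((Ψ x.toNNReal).restrict (b i)) := by
    ext i
    have hxT : x.toNNReal ≤ T := Real.toNNReal_le_iff_le_coe.2 hx.2
    have := h _ hxT (b i)
    rw [Real.coe_toNNReal x hx.1, ← Submodule.Quotient.mk_eq_zero, Submodule.Quotient.mk_sub,
      sub_eq_zero] at this
    exact this.symm
  have hbound : ∀ x ∈ Set.Ico (0 : ℝ) T, ‖f' x‖ ≤ (∑ i, L i) * ‖f x‖ := by
    intro x hx
    rw [hfΨ x (Set.Ico_subset_Icc_self hx)]
    have hxT : x.toNNReal ≤ T := Real.toNNReal_le_iff_le_coe.2 hx.2.le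
    refine (pi_norm_le_iff_of_nonneg
      (mul_nonneg (Finset.sum_nonneg fun i _ => hL i) (norm_nonneg _))).2 fun i => ?_
    refine (hLb i _ (hRb _ hxT)).trans ?_
    gcongr
    exact Finset.single_le_sum (f := L) (fun j _ => hL j) (Finset.mem_univ i)
  have hzero := eq_zero_of_abs_deriv_le_mul_abs_self_of_eq_zero_right
    (fun x _ => (hf x).continuousAt.continuousWithinAt)
    (fun x _ => (hf x).hasDerivWithinAt) hf0 hbound s ⟨s.2, hs⟩
  have hmem (i) : (Ψ s).restrict (b i) ∈ W := by
    have := congrFun ((hfΨ s ⟨s.2, hs⟩).symm.trans hzero) i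
    rw [Real.toNNReal_coe] at this
    exact (Submodule.Quotient.mk_eq_zero W).1 this
  rw [← b.sum_repr v, map_sum]
  exact W.sum_mem fun i _ => by
    rw [map_smul]
    exact W.smul_mem _ (hmem i)

end Invariance

/-! ### The past of the noise and its increments -/

section Past

variable {A : Type*} [NormedRing A] [NormedAlgebra ℂ A]
variable {V : Type*} [NormedAddCommGroup V] [InnerProductSpace ℝ V]
variable {E : Type*} [AddCommGroup E] [Module ℝ E]

variable (E) in
/-- The elements of `Λ(E ⊕ ⨁_{t ≥ 0} V)` whose contractions with all the increments of the noise
after the time `s` vanish. -/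
def past (C : V →L[ℝ] V) (s : ℝ≥0) : Subalgebra ℝ (ExteriorAlgebra ℝ (E × (ℝ≥0 →₀ V))) :=
  ⨅ i : Set.Ici s × V, contractKer (covariance E C (incr s i.1 i.2))

theorem mem_past {C : V →L[ℝ] V} {s : ℝ≥0} {p : ExteriorAlgebra ℝ (E × (ℝ≥0 →₀ V))} :
    p ∈ past E C s ↔ ∀ t, s ≤ t → ∀ v, p ∈ contractKer (covariance E C (incr s t v)) := by
  rw [past, Algebra.mem_iInf]
  exact ⟨fun h t ht v => h (⟨t, ht⟩, v), fun h i => h i.1 i.1.2 i.2⟩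

theorem ι_left_mem_past (C : V →L[ℝ] V) (s : ℝ≥0) (e : E) :
    ExteriorAlgebra.ι ℝ ((e, 0) : E × (ℝ≥0 →₀ V)) ∈ past E C s :=
  mem_past.2 fun _ _ _ => ι_mem_contractKer (by simp [covariance_apply])

theorem ι_single_mem_past [CompleteSpace V] (C : V →L[ℝ] V) {r s : ℝ≥0} (hr : r ≤ s) (v : V) :
    ExteriorAlgebra.ι ℝ ((0, Finsupp.single r v) : E × (ℝ≥0 →₀ V)) ∈ past E C s :=
  mem_past.2 fun _ ht _ => ι_mem_contractKer (covariance_incr_single C hr ht _ _ _)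

/-- The closed subalgebra of `A` generated by the initial condition and the noise up to the
time `s`. -/
def closedPast (C : V →L[ℝ] V) (Y : GVar A (E × (ℝ≥0 →₀ V))) (s : ℝ≥0) : Subalgebra ℝ A :=
  ((past E C s).map Y).topologicalClosure

/-- The odd part of `closedPast`. -/
def closedOddPast (C : V →L[ℝ] V) (Y : GVar A (E × (ℝ≥0 →₀ V))) (s : ℝ≥0) : Submodule ℝ A :=
  (((past E C s).toSubmodule ⊓ parity (E × (ℝ≥0 →₀ V)) 1).map Y.toLinearMap).topologicalClosure

variable {C : V →L[ℝ] V} {Y : GVar A (E × (ℝ≥0 →₀ V))} {s : ℝ≥0}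

theorem isClosed_closedOddPast : IsClosed (closedOddPast C Y s : Set A) :=
  Submodule.isClosed_topologicalClosure _

theorem apply_mem_closedOddPast {p : ExteriorAlgebra ℝ (E × (ℝ≥0 →₀ V))} (hp : p ∈ past E C s)
    (hp' : p ∈ parity (E × (ℝ≥0 →₀ V)) 1) : Y p ∈ closedOddPast C Y s :=
  Submodule.le_topologicalClosure _ ⟨p, ⟨hp, hp'⟩, rfl⟩

theorem closedOddPast_induction {P : A → Prop} (hP : IsClosed {x | P x})
    (h : ∀ p ∈ past E C s, p ∈ parity (E × (ℝ≥0 →₀ V)) 1 → P (Y p)) {x : A}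
    (hx : x ∈ closedOddPast C Y s) : P x :=
  closure_minimal (t := {x | P x}) (by rintro _ ⟨p, hp, rfl⟩; exact h p hp.1 hp.2) hP hx

theorem closedPast_induction {P : A → Prop} (hP : IsClosed {x | P x})
    (h : ∀ p ∈ past E C s, P (Y p)) {x : A} (hx : x ∈ closedPast C Y s) : P x :=
  closure_minimal (t := {x | P x}) (by rintro _ ⟨p, hp, rfl⟩; exact h p hp) hP hx

theorem closedOddPast_le_closedPast {x : A} (hx : x ∈ closedOddPast C Y s) :
    x ∈ closedPast C Y s :=
  closedOddPast_induction (Subalgebra.isClosed_topologicalClosure _)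
    (fun p hp _ => Subalgebra.le_topologicalClosure _ (Subalgebra.mem_map.2 ⟨p, hp, rfl⟩)) hx

theorem restrict_left_mem_closedOddPast (e : E) : Y.restrict (e, 0) ∈ closedOddPast C Y s :=
  apply_mem_closedOddPast (ι_left_mem_past C s e) (CliffordAlgebra.ι_mem_evenOdd_one _ _)

theorem restrict_single_mem_closedOddPast [CompleteSpace V] {r : ℝ≥0} (hr : r ≤ s) (v : V) :
    Y.restrict (0, Finsupp.single r v) ∈ closedOddPast C Y s :=
  apply_mem_closedOddPast (ι_single_mem_past C hr v) (CliffordAlgebra.ι_mem_evenOdd_one _ _)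

theorem mul_mul_mem_closedOddPast {x y z : A} (hx : x ∈ closedOddPast C Y s)
    (hy : y ∈ closedOddPast C Y s) (hz : z ∈ closedOddPast C Y s) :
    x * y * z ∈ closedOddPast C Y s := by
  have hc := isClosed_closedOddPast (C := C) (Y := Y) (s := s)
  refine closedOddPast_induction (P := fun x => x * y * z ∈ closedOddPast C Y s)
    (hc.preimage (f := fun x => x * y * z) (by fun_prop)) (fun p hp hp' => ?_) hx
  refine closedOddPast_induction (P := fun y => Y p * y * z ∈ closedOddPast C Y s)
    (hc.preimage (f := fun y => Y p * y * z) (by fun_prop)) (fun q hq hq' => ?_) hy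
  refine closedOddPast_induction (P := fun z => Y p * Y q * z ∈ closedOddPast C Y s)
    (hc.preimage (f := fun z => Y p * Y q * z) (by fun_prop)) (fun r hr hr' => ?_) hz
  have hpar : p * q * r ∈ parity (E × (ℝ≥0 →₀ V)) (1 + 1 + 1) :=
    SetLike.mul_mem_graded (SetLike.mul_mem_graded hp' hq') hr'
  rw [show (1 + 1 + 1 : ZMod 2) = 1 from by decide] at hpar
  have h := apply_mem_closedOddPast (Y := Y) (mul_mem (mul_mem hp hq) hr) hpar
  rwa [map_mul, map_mul] at h

/-- Anticommutation is a closed condition, so it survives the closure; this is why the parity is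
tracked along with the past. -/
theorem restrict_mul_eq_neg (m : E × (ℝ≥0 →₀ V)) {x : A} (hx : x ∈ closedOddPast C Y s) :
    Y.restrict m * x = -(x * Y.restrict m) := by
  refine closedOddPast_induction (P := fun x => Y.restrict m * x = -(x * Y.restrict m))
    (isClosed_eq (by fun_prop) (by fun_prop)) (fun p _ hp => ?_) hx
  change Y (ExteriorAlgebra.ι ℝ m) * Y p = -(Y p * Y (ExteriorAlgebra.ι ℝ m))
  rw [← map_mul, ι_mul_eq_neg_mul_ι m hp, map_neg, map_mul]

theorem restrict_mul_restrict (m n : E × (ℝ≥0 →₀ V)) :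
    Y.restrict m * Y.restrict n = -(Y.restrict n * Y.restrict m) := by
  change Y (ExteriorAlgebra.ι ℝ m) * Y (ExteriorAlgebra.ι ℝ n)
    = -(Y (ExteriorAlgebra.ι ℝ n) * Y (ExteriorAlgebra.ι ℝ m))
  rw [← map_mul, ι_mul_eq_neg_mul_ι m (CliffordAlgebra.ι_mem_evenOdd_one _ n), map_neg, map_mul]

theorem apply_mem_closedPast {E' : Type*} [AddCommGroup E'] [Module ℝ E'] {X : GVar A E'}
    (hX : ∀ v, X.restrict v ∈ closedPast C Y s) (G : ExteriorAlgebra ℝ E') :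
    X G ∈ closedPast C Y s := by
  induction G using ExteriorAlgebra.induction with
  | algebraMap r => rw [AlgHom.commutes]; exact Subalgebra.algebraMap_mem _ r
  | ι v => exact hX v
  | mul a b ha hb => rw [map_mul]; exact mul_mem ha hb
  | add a b ha hb => rw [map_add]; exact add_mem ha hb

section Wick

variable {ω : A →L[ℂ] ℂ}
  (hω : ∀ p n, ω (Y p * Y.restrict (0, n))
    = ω (Y (CliffordAlgebra.contractRight p (covariance E C n))))
include hω

/-- The martingale property of the noise. -/
theorem apply_mul_incr {t : ℝ≥0} (h : s ≤ t) (v : V) {a : A} (ha : a ∈ closedPast C Y s) :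
    ω (a * Y.restrict (0, incr s t v)) = 0 := by
  refine closedPast_induction (P := fun a => ω (a * Y.restrict (0, incr s t v)) = 0)
    (isClosed_eq (by fun_prop) (by fun_prop)) (fun p hp => ?_) ha
  rw [hω, (mem_past.1 hp t h v).1, map_zero, map_zero]

/-- The quadratic variation: contracting `p * v` with the second increment can only hit the first
one. -/
theorem apply_mul_incr_mul_incr [CompleteSpace V] {t : ℝ≥0} (h : s ≤ t) (v w : V) {a : A}
    (ha : a ∈ closedPast C Y s) :
    ω (a * Y.restrict (0, incr s t v) * Y.restrict (0, incr s t w))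
      = (((t : ℝ) - s) * inner ℝ v (C w)) • ω a := by
  refine closedPast_induction
    (P := fun a => ω (a * Y.restrict (0, incr s t v) * Y.restrict (0, incr s t w))
      = (((t : ℝ) - s) * inner ℝ v (C w)) • ω a)
    (isClosed_eq (by fun_prop) (by fun_prop)) (fun p hp => ?_) ha
  have hm : Y p * Y.restrict (0, incr s t v)
      = Y (p * ExteriorAlgebra.ι ℝ (0, incr s t v)) := (map_mul Y _ _).symm
  rw [hm, hω, contractRight_mul_ι_of_mem (mem_past.1 hp t h w), covariance_incr_incr C h,
    map_smul]
  exact (ω.restrictScalars ℝ).map_smul _ _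

end Wick

end Past

/-! ### Second order expansion of a perturbed Grassmann variable -/

section Expansion

variable {A : Type*} [NormedRing A] [NormedAlgebra ℂ A]
variable {V : Type*} [AddCommGroup V] [Module ℝ V]

/-- The linear map `f ⊗ v ↦ ψ(f) N(v)`. -/
def firstOrder (ψ : GVar A V) (N : V →ₗ[ℝ] A) : ExteriorAlgebra ℝ V ⊗[ℝ] V →ₗ[ℝ] A :=
  LinearMap.mul' ℝ A ∘ₗ TensorProduct.map ψ.toLinearMap N

/-- The linear map `f ⊗ v ⊗ w ↦ ψ(f) N(v) N(w)`. -/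
def secondOrder (ψ : GVar A V) (N : V →ₗ[ℝ] A) :
    (ExteriorAlgebra ℝ V ⊗[ℝ] V) ⊗[ℝ] V →ₗ[ℝ] A :=
  LinearMap.mul' ℝ A ∘ₗ TensorProduct.map (firstOrder ψ N) N

variable {ψ : GVar A V} {N : V →ₗ[ℝ] A}

theorem firstOrder_tmul (f : ExteriorAlgebra ℝ V) (v : V) :
    firstOrder ψ N (f ⊗ₜ v) = ψ f * N v := by
  simp [firstOrder]

theorem secondOrder_tmul (K : ExteriorAlgebra ℝ V ⊗[ℝ] V) (v : V) :
    secondOrder ψ N (K ⊗ₜ v) = firstOrder ψ N K * N v := by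
  simp [secondOrder]

theorem firstOrder_mulRightι (hN : ∀ v w, N v * ψ.restrict w = -(ψ.restrict w * N v)) (v : V)
    (K : ExteriorAlgebra ℝ V ⊗[ℝ] V) :
    firstOrder ψ N (mulRightι V v K) = -(firstOrder ψ N K * ψ.restrict v) := by
  induction K using TensorProduct.induction_on with
  | zero => simp
  | add x y hx hy => simp only [map_add, add_mul, hx, hy, neg_add]
  | tmul f w =>
    rw [mulRightι_tmul, firstOrder_tmul, firstOrder_tmul, map_mul, mul_assoc, mul_assoc, hN,
      mul_neg, neg_neg]
    rfl

theorem firstOrder_rightDeriv_mul_ι (hN : ∀ v w, N v * ψ.restrict w = -(ψ.restrict w * N v))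
    (G : ExteriorAlgebra ℝ V) (v : V) :
    firstOrder ψ N (rightDeriv V (G * ExteriorAlgebra.ι ℝ v))
      = ψ G * N v + firstOrder ψ N (rightDeriv V G) * ψ.restrict v := by
  rw [rightDeriv_mul_ι, map_sub, firstOrder_mulRightι hN, firstOrder_tmul, sub_neg_eq_add]

/-- The new generator can be removed first or second; anticommutation of the `N` makes the two
contributions equal. The resulting `2` is compensated by the `½` in the expansion. -/
theorem secondOrder_rightDeriv₂_mul_ι
    (hN : ∀ v w, N v * ψ.restrict w = -(ψ.restrict w * N v))
    (hNN : ∀ v w, N v * N w = -(N w * N v)) (G : ExteriorAlgebra ℝ V) (v : V) :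
    secondOrder ψ N (rightDeriv₂ V (G * ExteriorAlgebra.ι ℝ v))
      = (2 : ℝ) • (firstOrder ψ N (rightDeriv V G) * N v)
        + secondOrder ψ N (rightDeriv₂ V G) * ψ.restrict v := by
  have key (K : ExteriorAlgebra ℝ V ⊗[ℝ] V) :
      secondOrder ψ N (LinearMap.rTensor V (rightDeriv V) (mulRightι V v K))
        = -(firstOrder ψ N K * N v)
          - secondOrder ψ N (LinearMap.rTensor V (rightDeriv V) K) * ψ.restrict v := by
    induction K using TensorProduct.induction_on with
    | zero => simp
    | add x y hx hy => simp only [map_add, add_mul, hx, hy]; abel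
    | tmul f w =>
      rw [mulRightι_tmul, LinearMap.rTensor_tmul, LinearMap.rTensor_tmul, secondOrder_tmul,
        secondOrder_tmul, firstOrder_rightDeriv_mul_ι hN, firstOrder_tmul, add_mul, mul_assoc,
        mul_assoc, mul_assoc, mul_assoc, hNN v w, hN w v]
      noncomm_ring
  rw [rightDeriv₂_mul_ι, map_sub, secondOrder_tmul, key, two_smul]
  rw [show rightDeriv₂ V G = LinearMap.rTensor V (rightDeriv V) (rightDeriv V G) from rfl]
  abel

open Asymptotics Filter Topology

variable {T : Type*} {l : Filter T} {k : T → ℝ} {N : T → V →ₗ[ℝ] A} {D : T → V → A}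
  {φ : T → GVar A V} {F : V →ₗ[ℝ] ExteriorAlgebra ℝ V}

theorem isBigO_firstOrder (hN : ∀ v, (fun t => N t v) =O[l] k)
    (K : ExteriorAlgebra ℝ V ⊗[ℝ] V) : (fun t => firstOrder ψ (N t) K) =O[l] k := by
  induction K using TensorProduct.induction_on with
  | zero => simpa using isBigO_zero _ _
  | add x y hx hy => simpa using hx.add hy
  | tmul f v =>
    simp only [firstOrder_tmul]
    exact (hN v).const_mul_left _

theorem isBigO_secondOrder (hN : ∀ v, (fun t => N t v) =O[l] k)
    (K : (ExteriorAlgebra ℝ V ⊗[ℝ] V) ⊗[ℝ] V) :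
    (fun t => secondOrder ψ (N t) K) =O[l] fun t => k t ^ 2 := by
  induction K using TensorProduct.induction_on with
  | zero => simpa using isBigO_zero _ _
  | add x y hx hy => simpa using hx.add hy
  | tmul f v =>
    simp only [secondOrder_tmul, pow_two]
    exact (isBigO_firstOrder hN f).mul (hN v)

/-- The expansion for `G` is multiplied by that of the last generator. With `N` of order `k` and `D`
of order `k²`, everything of order three or more is discarded. -/
theorem isLittleO_expansion (hF : ∀ v, F v ∈ parity V 1) (hk : Tendsto k l (𝓝 0))
    (hN : ∀ v, (fun t => N t v) =O[l] k)
    (hD : ∀ v, (fun t => D t v - k t ^ 2 • ψ (F v)) =o[l] fun t => k t ^ 2)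
    (hψN : ∀ t v w, N t v * ψ.restrict w = -(ψ.restrict w * N t v))
    (hNN : ∀ t v w, N t v * N t w = -(N t w * N t v))
    (hφ : ∀ t v, (φ t).restrict v = ψ.restrict v + N t v + D t v) (G : ExteriorAlgebra ℝ V) :
    (fun t => φ t G - (ψ G + firstOrder ψ (N t) (rightDeriv V G)
        + (1 / 2 : ℝ) • secondOrder ψ (N t) (rightDeriv₂ V G)
        + k t ^ 2 • ψ (dot F (rightDeriv V G)))) =o[l] fun t => k t ^ 2 := by
  have hk1 : k =o[l] fun _ => (1 : ℝ) := (isLittleO_one_iff ℝ).2 hk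
  have hk2 : (fun t => k t ^ 2) =o[l] k := by
    simpa only [pow_two, one_mul] using hk1.mul_isBigO (isBigO_refl k l)
  have hDO (v : V) : (fun t => D t v) =O[l] fun t => k t ^ 2 := by
    have h1 : (fun t => k t ^ 2 • ψ (F v)) =O[l] fun t => k t ^ 2 := by
      simpa using (isBigO_refl (fun t => k t ^ 2) l).smul
        (isBigO_const_const (ψ (F v)) (one_ne_zero (α := ℝ)) l)
    simpa using (hD v).isBigO.add h1
  have hND (v : V) : (fun t => N t v + D t v) =O[l] k := (hN v).add (hDO v |>.trans hk2.isBigO)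
  have hsmall {f g : T → A} (hf : f =O[l] fun t => k t ^ 2) (hg : g =O[l] k) :
      (fun t => f t * g t) =o[l] fun t => k t ^ 2 := by
    simpa using hf.mul_isLittleO (hg.trans_isLittleO hk1)
  induction G using CliffordAlgebra.right_induction with
  | algebraMap r =>
    have h1 : rightDeriv V (algebraMap ℝ _ r) = 0 := rightDeriv_algebraMap r
    have h2 : rightDeriv₂ V (algebraMap ℝ _ r) = 0 := by
      rw [rightDeriv₂, LinearMap.comp_apply, h1, map_zero]
    simp only [h1, h2, map_zero, AlgHom.commutes, smul_zero, add_zero, sub_self]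
    exact isLittleO_zero _ _
  | add x y hx hy =>
    refine (hx.add hy).congr_left fun t => ?_
    simp only [map_add, smul_add]
    abel
  | mul_ι v G hG =>
    have hφO : (fun t => (φ t).restrict v) =O[l] fun _ => (1 : ℝ) := by
      simp only [hφ, add_assoc]
      exact (isBigO_const_const _ one_ne_zero l).add ((hND v).trans hk1.isBigO)
    -- `e1` is the inductive remainder times a bounded factor and `e2` the error of the drift at the
    -- last generator; `e3`, `e4`, `e5` collect the cross terms of order at least three.
    have e1 : (fun t => (φ t G - (ψ G + firstOrder ψ (N t) (rightDeriv V G)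
        + (1 / 2 : ℝ) • secondOrder ψ (N t) (rightDeriv₂ V G)
        + k t ^ 2 • ψ (dot F (rightDeriv V G)))) * (φ t).restrict v) =o[l] fun t => k t ^ 2 := by
      simpa using hG.mul_isBigO hφO
    have e2 : (fun t => ψ G * (D t v - k t ^ 2 • ψ (F v))) =o[l] fun t => k t ^ 2 :=
      (hD v).const_mul_left _
    have e3 : (fun t => firstOrder ψ (N t) (rightDeriv V G) * D t v)
        =o[l] fun t => k t ^ 2 := by
      simpa using ((isBigO_firstOrder hN _).trans_isLittleO hk1).mul_isBigO (hDO v)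
    have e4 : (fun t => (1 / 2 : ℝ) • secondOrder ψ (N t) (rightDeriv₂ V G)
        * (N t v + D t v)) =o[l] fun t => k t ^ 2 :=
      hsmall ((isBigO_secondOrder hN _).const_smul_left _) (hND v)
    have e5 : (fun t => k t ^ 2 • ψ (dot F (rightDeriv V G)) * (N t v + D t v))
        =o[l] fun t => k t ^ 2 := by
      refine hsmall ?_ (hND v)
      simpa using (isBigO_refl (fun t => k t ^ 2) l).smul
        (isBigO_const_const (ψ (dot F (rightDeriv V G))) (one_ne_zero (α := ℝ)) l)
    refine ((((e1.add e2).add e3).add e4).add e5).congr_left fun t => ?_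
    have h1 := firstOrder_rightDeriv_mul_ι (hψN t) G v
    have h2 := secondOrder_rightDeriv₂_mul_ι (hψN t) (hNN t) G v
    have h3 : dot F (rightDeriv V (G * ExteriorAlgebra.ι ℝ v))
        = G * F v + dot F (rightDeriv V G) * ExteriorAlgebra.ι ℝ v := by
      rw [rightDeriv_mul_ι, map_sub, dot_mulRightι hF, dot_tmul, sub_neg_eq_add]
    have h4 : ∀ X : GVar A V, X (G * ExteriorAlgebra.ι ℝ v) = X G * X.restrict v :=
      fun X => map_mul X _ _
    change _ = φ t (G * ExteriorAlgebra.ι ℝ v) - (ψ (G * ExteriorAlgebra.ι ℝ v)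
      + firstOrder ψ (N t) (rightDeriv V (G * ExteriorAlgebra.ι ℝ v))
      + (1 / 2 : ℝ) • secondOrder ψ (N t) (rightDeriv₂ V (G * ExteriorAlgebra.ι ℝ v))
      + k t ^ 2 • ψ (dot F (rightDeriv V (G * ExteriorAlgebra.ι ℝ v))))
    have h5 : ψ (dot F (rightDeriv V G) * ExteriorAlgebra.ι ℝ v)
        = ψ (dot F (rightDeriv V G)) * ψ.restrict v := map_mul ψ _ _
    rw [h1, h2, h3, map_add, h4 (φ t), h4 ψ, h5, map_mul ψ G, hφ]
    simp only [mul_add, add_mul, sub_mul, mul_sub, smul_add, smul_smul, smul_mul_assoc,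
      mul_smul_comm]
    norm_num
    abel

end Expansion

/-! ### Itô's formula -/

section Ito

open Asymptotics Filter Topology

variable {A : Type*} [NormedRing A] [NormedAlgebra ℂ A]
variable {V : Type*} [NormedAddCommGroup V] [InnerProductSpace ℝ V]

theorem isBigO_restrict_incr [CompleteSpace V] {E : Type*} [AddCommGroup E] [Module ℝ E]
    {Y : GVar A (E × (ℝ≥0 →₀ V))} {Ξ : GVar A (Lp V 2 (volume : Measure ℝ))}
    (hΞ : Continuous Ξ.restrict)
    (hY : ∀ w, Y.restrict (0, w) = Ξ.restrict (indicatorSum V w)) (s : ℝ≥0) (v : V) :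
    (fun x : ℝ => Y.restrict (0, incr s x.toNNReal v)) =O[𝓝[>] (s : ℝ)] fun x => √(x - s) := by
  let Ξ' : Lp V 2 (volume : Measure ℝ) →L[ℝ] A := ⟨Ξ.restrict, hΞ⟩
  refine IsBigO.of_bound (‖Ξ'‖ * ‖v‖) ?_
  filter_upwards [self_mem_nhdsWithin] with x hx
  have hx0 : (0 : ℝ) ≤ x := s.2.trans (le_of_lt hx)
  have hsx : s ≤ x.toNNReal := (Real.le_toNNReal_iff_coe_le hx0).2 (le_of_lt hx)
  rw [hY]
  refine (Ξ'.le_opNorm _).trans_eq ?_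
  rw [norm_indicatorSum_incr hsx, Real.coe_toNNReal x hx0, Real.norm_of_nonneg (Real.sqrt_nonneg _)]
  ring

variable [CompleteSpace A] [FiniteDimensional ℝ V]

theorem hasDerivWithinAt_expectation {ω : A →L[ℂ] ℂ} {C : V →L[ℝ] V}
    {F : V →ₗ[ℝ] ExteriorAlgebra ℝ V} (hF : ∀ v, F v ∈ parity V 1)
    {Y : GVar A (V × (ℝ≥0 →₀ V))}
    (hω : ∀ p n, ω (Y p * Y.restrict (0, n))
      = ω (Y (CliffordAlgebra.contractRight p (covariance V C n))))
    (hN : ∀ (s : ℝ≥0) (v : V), (fun x : ℝ => Y.restrict (0, incr s x.toNNReal v))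
      =O[𝓝[>] (s : ℝ)] fun x => √(x - s))
    {Ψ₀ : GVar A V} (hΨ₀ : ∀ v, Ψ₀.restrict v = Y.restrict (v, 0))
    {Ψ : ℝ≥0 → GVar A V} (hΨ : Continuous fun t => (Ψ t).restrictL)
    (hsol : ∀ t v, (Ψ t).restrict v = Y.restrict (v, 0)
      + (∫ s in (0 : ℝ)..t, Ψ s.toNNReal (F v)) + Y.restrict (0, Finsupp.single t v))
    (G H : ExteriorAlgebra ℝ V) (s : ℝ≥0) :
    HasDerivWithinAt (fun x : ℝ => ω (Ψ x.toNNReal G * Ψ₀ H))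
      (ω (Ψ s (generator F C G) * Ψ₀ H)) (Set.Ioi (s : ℝ)) s := by
  have : CompleteSpace V := FiniteDimensional.complete ℝ V
  have hcont (G : ExteriorAlgebra ℝ V) : Continuous fun r : ℝ => Ψ r.toNNReal G :=
    (continuous_apply_of_restrictL hΨ G).comp continuous_real_toNNReal
  have hodd (v : V) : (Ψ s).restrict v ∈ closedOddPast C Y s := by
    refine restrict_mem_of_drift isClosed_closedOddPast
      (fun x hx y hy z hz => mul_mul_mem_closedOddPast hx hy hz) hF hΨ (T := s)
      (fun r hr v => ?_) le_rfl v
    rw [hsol, add_right_comm, add_sub_cancel_right]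
    exact add_mem (restrict_left_mem_closedOddPast v) (restrict_single_mem_closedOddPast hr v)
  have hodd₀ (v : V) : Ψ₀.restrict v ∈ closedOddPast C Y s :=
    hΨ₀ v ▸ restrict_left_mem_closedOddPast v
  have hmem (f H : ExteriorAlgebra ℝ V) : Ψ s f * Ψ₀ H ∈ closedPast C Y s :=
    mul_mem (apply_mem_closedPast (fun v => closedOddPast_le_closedPast (hodd v)) f)
      (apply_mem_closedPast (fun v => closedOddPast_le_closedPast (hodd₀ v)) H)
  let N : ℝ → V →ₗ[ℝ] A := fun x =>
    Y.restrict ∘ₗ LinearMap.inr ℝ V (ℝ≥0 →₀ V) ∘ₗ incr s x.toNNReal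
  have hNap (x v) : N x v = Y.restrict (0, incr s x.toNNReal v) := rfl
  -- The upper limit is `x.toNNReal` so that the decomposition of `Ψ` holds for every real `x`; it
  -- equals `x` for `x > s`.
  let D : ℝ → V → A := fun x v => ∫ r in (s : ℝ)..x.toNNReal, Ψ r.toNNReal (F v)
  have hΨN (x v w) : N x v * (Ψ s).restrict w = -((Ψ s).restrict w * N x v) :=
    restrict_mul_eq_neg _ (hodd w)
  -- The Wick rule needs the increments rightmost, so `Ψ₀ H` has to be moved to their left. For two
  -- increments the involutions cancel.
  have hΨ₀N (x : ℝ) (v : V) (H : ExteriorAlgebra ℝ V) :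
      N x v * Ψ₀ H = Ψ₀ (CliffordAlgebra.involute H) * N x v := by
    induction H using CliffordAlgebra.right_induction with
    | algebraMap r => rw [AlgHom.commutes, AlgHom.commutes, AlgHom.commutes, Algebra.commutes]
    | add a b ha hb => rw [map_add, map_add, map_add, mul_add, add_mul, ha, hb]
    | mul_ι w a ha =>
      have h : N x v * Ψ₀ (CliffordAlgebra.ι _ w) = -(Ψ₀ (CliffordAlgebra.ι _ w) * N x v) :=
        restrict_mul_eq_neg _ (hodd₀ w)
      rw [map_mul, map_mul, map_mul, ← mul_assoc, ha, mul_assoc, h, CliffordAlgebra.involute_ι,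
        map_neg]
      noncomm_ring
  have hexp := isLittleO_expansion (ψ := Ψ s) (φ := fun x : ℝ => Ψ x.toNNReal) (N := N) (D := D)
    (k := fun x : ℝ => √(x - s)) (l := 𝓝[>] (s : ℝ)) hF
    (by
      have : Tendsto (fun x : ℝ => √(x - s)) (𝓝 (s : ℝ)) (𝓝 √((s : ℝ) - s)) :=
        Continuous.tendsto (by fun_prop) _
      rw [sub_self, Real.sqrt_zero] at this
      exact this.mono_left nhdsWithin_le_nhds)
    (hN s)
    (fun v => by
      have hd : HasDerivAt (fun x : ℝ => ∫ r in (s : ℝ)..x, Ψ r.toNNReal (F v))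
          (Ψ (s : ℝ).toNNReal (F v)) s :=
        ((hcont (F v)).integral_hasStrictDerivAt _ _).hasDerivAt
      rw [hasDerivAt_iff_isLittleO] at hd
      refine (hd.mono nhdsWithin_le_nhds).congr' ?_ ?_
      · filter_upwards [self_mem_nhdsWithin] with x hx
        have hx' : (s : ℝ) < x := hx
        rw [intervalIntegral.integral_same, sub_zero, Real.sq_sqrt (sub_nonneg.2 hx'.le),
          Real.toNNReal_coe]
        simp only [D]
        rw [Real.coe_toNNReal x (s.2.trans hx'.le)]
      · filter_upwards [self_mem_nhdsWithin] with x hx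
        have hx' : (s : ℝ) < x := hx
        rw [Real.sq_sqrt (sub_nonneg.2 hx'.le)])
    hΨN (fun x v w => restrict_mul_restrict _ _)
    (fun x v => by
      have hint : (∫ r in (0 : ℝ)..x.toNNReal, Ψ r.toNNReal (F v))
          = (∫ r in (0 : ℝ)..s, Ψ r.toNNReal (F v)) + D x v :=
        (intervalIntegral.integral_add_adjacent_intervals
          ((hcont _).intervalIntegrable _ _) ((hcont _).intervalIntegrable _ _)).symm
      have hinc : ((0, incr s x.toNNReal v) : V × (ℝ≥0 →₀ V))
          = (0, Finsupp.single x.toNNReal v) - (0, Finsupp.single s v) := by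
        simp [incr]
      rw [hsol, hsol, hNap, hint, hinc, map_sub]
      abel) G
  have hfirst {x : ℝ} (hx : s ≤ x.toNNReal) (K : ExteriorAlgebra ℝ V ⊗[ℝ] V) :
      ω (firstOrder (Ψ s) (N x) K * Ψ₀ H) = 0 := by
    induction K using TensorProduct.induction_on with
    | zero => simp
    | add a b ha hb => rw [map_add, add_mul, map_add, ha, hb, add_zero]
    | tmul f v =>
      rw [firstOrder_tmul, mul_assoc, hΨ₀N, ← mul_assoc]
      exact apply_mul_incr hω hx v (hmem f _)
  have hsecond {x : ℝ} (hx : s ≤ x.toNNReal) (K : (ExteriorAlgebra ℝ V ⊗[ℝ] V) ⊗[ℝ] V) :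
      ω (secondOrder (Ψ s) (N x) K * Ψ₀ H)
        = ((x.toNNReal : ℝ) - s) • ω (Ψ s (quad C K) * Ψ₀ H) := by
    induction K using TensorProduct.induction_on with
    | zero => simp
    | add a b ha hb => simp only [map_add, add_mul, ha, hb, smul_add]
    | tmul K w =>
      induction K using TensorProduct.induction_on with
      | zero => simp
      | add a b ha hb => simp only [TensorProduct.add_tmul, map_add, add_mul, ha, hb, smul_add]
      | tmul f v =>
        rw [secondOrder_tmul, firstOrder_tmul, quad_tmul, mul_assoc, hΨ₀N, mul_assoc,
          ← mul_assoc (N x v), hΨ₀N, CliffordAlgebra.involute_involute, ← mul_assoc, ← mul_assoc]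
        refine (apply_mul_incr_mul_incr hω hx v w (hmem f H)).trans ?_
        rw [map_smul, smul_mul_assoc, mul_smul]
        congr 1
        exact ((ω.restrictScalars ℝ).map_smul _ _).symm
  rw [hasDerivWithinAt_iff_isLittleO]
  -- Being bounded, `a ↦ ω (a * Ψ₀ H)` carries the remainder in `A` to a remainder in `ℂ`.
  let Λ : A →L[ℝ] ℂ := (ω.restrictScalars ℝ) ∘L ((ContinuousLinearMap.mul ℝ A).flip (Ψ₀ H))
  have hΛ (a : A) : Λ a = ω (a * Ψ₀ H) := rfl
  refine ((Λ.isBigO_comp _ _).trans_isLittleO hexp).congr' ?_ ?_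
  · filter_upwards [self_mem_nhdsWithin] with x hx
    have hx' : (s : ℝ) < x := hx
    have hx0 : (0 : ℝ) ≤ x := s.2.trans hx'.le
    have hsx : s ≤ x.toNNReal := (Real.le_toNNReal_iff_coe_le hx0).2 hx'.le
    rw [Real.sq_sqrt (sub_nonneg.2 hx'.le), Real.toNNReal_coe, ← hΛ, ← hΛ, ← hΛ, generator,
      map_sub, map_add, map_add, map_add, map_smul, map_smul, hΛ (firstOrder _ _ _), hfirst hsx,
      hΛ (secondOrder _ _ _), hsecond hsx, ← hΛ, Real.coe_toNNReal x hx0, map_add, map_smul,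
      map_add, map_smul]
    module
  · filter_upwards [self_mem_nhdsWithin] with x hx
    have hx' : (s : ℝ) < x := hx
    rw [Real.sq_sqrt (sub_nonneg.2 hx'.le)]

theorem ito_formula {ω : A →L[ℂ] ℂ} {C : V →L[ℝ] V} {B : ℝ≥0 → GVar A V}
    (hB : IsBrownianMotion ω C B) {F : V →ₗ[ℝ] ExteriorAlgebra ℝ V}
    (hF : ∀ v, F v ∈ parity V 1) {Ψ₀ : GVar A V} (hΨ₀ : IndependentOfProcess ω Ψ₀ B)
    {Ψ : ℝ≥0 → GVar A V} (hΨ : IsGlobalSolution F B Ψ₀ Ψ) (G H : ExteriorAlgebra ℝ V) (t : ℝ≥0) :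
    IntervalIntegrable
        (fun s : ℝ => ω (Ψ s.toNNReal (generator F C G) * Ψ₀ H)) volume 0 t ∧
      ω (Ψ t G * Ψ₀ H) =
        ω (Ψ₀ G * Ψ₀ H) +
          ∫ s in (0 : ℝ)..t, ω (Ψ s.toNNReal (generator F C G) * Ψ₀ H) := by
  have : CompleteSpace V := FiniteDimensional.complete ℝ V
  obtain ⟨Ξ, hΞ, hBΞ⟩ := hB
  obtain ⟨Z, hZ, ⟨Y, hY⟩, hind⟩ := hΨ₀
  -- A joint variable is determined by its values on generators, so it is the pullback of the white
  -- noise.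
  have hZΞ : Z = Ξ.comp (ExteriorAlgebra.map (indicatorSum V)) := by
    apply ExteriorAlgebra.hom_ext
    refine Finsupp.lhom_ext fun r v => ?_
    have := (hZ r v).trans (hBΞ r v)
    simpa [GVar.restrict] using this
  have hZΞ' (w) : Z.restrict w = Ξ.restrict (indicatorSum V w) := by
    simp [hZΞ, GVar.restrict]
  have hY₀ (v : V) : Ψ₀.restrict v = Y.restrict (v, 0) := by
    rw [hY, map_zero, add_zero]
  have hY₁ (w) : Y.restrict (0, w) = Z.restrict w := by
    rw [hY, map_zero, zero_add]
  have hω := wick_of_independent hΞ (X := Ψ₀) (Y := Y)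
    (fun P Q => by simpa [hZΞ] using hind P Q) (fun v w => by rw [hY, hZΞ'])
  have hΨ0 : Ψ 0 = Ψ₀ := by
    apply ExteriorAlgebra.hom_ext
    ext v
    -- The interval `[0,0]` is null, so the noise vanishes at time zero and `Ψ 0` is the initial
    -- condition.
    have h0 : indicatorVec 0 v = 0 := by
      have h := inner_indicatorVec 0 0 v v
      rw [min_self, NNReal.coe_zero, zero_mul] at h
      exact inner_self_eq_zero.1 h
    have h := hΨ.eqn 0 v
    rw [hBΞ, h0, map_zero, add_zero, NNReal.coe_zero, intervalIntegral.integral_same,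
      add_zero] at h
    exact h
  have hderiv := hasDerivWithinAt_expectation (Ψ := Ψ) hF hω
    (isBigO_restrict_incr hΞ.bounded fun w => (hY₁ w).trans (hZΞ' w)) hY₀ hΨ.continuous
    (fun r v => by rw [hΨ.eqn, ← hY₀, hY₁, hZ]) G H
  have hcont (G : ExteriorAlgebra ℝ V) : Continuous fun r : ℝ => ω (Ψ r.toNNReal G * Ψ₀ H) := by
    have := (continuous_apply_of_restrictL hΨ.continuous G).comp continuous_real_toNNReal
    exact ω.continuous.comp (this.mul continuous_const)
  have hint := (hcont (generator F C G)).intervalIntegrable (μ := volume) 0 t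
  refine ⟨hint, ?_⟩
  -- For a continuous function with continuous right derivative, right derivatives suffice in the
  -- fundamental theorem of calculus.
  rw [intervalIntegral.integral_eq_sub_of_hasDeriv_right (hcont G).continuousOn
    (fun x hx => ?_) hint]
  · rw [Real.toNNReal_coe, Real.toNNReal_zero, hΨ0]
    ring
  · have hx0 : 0 ≤ x := (le_min le_rfl t.coe_nonneg).trans hx.1.le
    have := hderiv x.toNNReal
    rwa [Real.coe_toNNReal x hx0] at this

end Ito

end Grassmann

end

theorem theorem32
    {𝓗 : Type*} [NormedAddCommGroup 𝓗] [InnerProductSpace ℂ 𝓗] [CompleteSpace 𝓗]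
    {V : Type*} [NormedAddCommGroup V] [InnerProductSpace ℝ V] [FiniteDimensional ℝ V]
    (ω : (𝓗 →L[ℂ] 𝓗) →L[ℂ] ℂ) (hω : IsState (𝓗 →L[ℂ] 𝓗) ω)
    (C : V →L[ℝ] V) (B : ℝ≥0 → GVar (𝓗 →L[ℂ] 𝓗) V) (hB : IsBrownianMotion ω C B)
    (F : V →ₗ[ℝ] ExteriorAlgebra ℝ V) (hF : ∀ v, F v ∈ parity V 1)
    (Ψ₀ : GVar (𝓗 →L[ℂ] 𝓗) V) (hΨ₀ : IndependentOfProcess ω Ψ₀ B)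
    (Ψ : ℝ≥0 → GVar (𝓗 →L[ℂ] 𝓗) V) (hΨ : IsGlobalSolution F B Ψ₀ Ψ)
    (G H : ExteriorAlgebra ℝ V) (t : ℝ≥0) :
    IntervalIntegrable
        (fun s : ℝ => ω (Ψ s.toNNReal (generator F C G) * Ψ₀ H)) volume 0 t ∧
      ω (Ψ t G * Ψ₀ H) =
        ω (Ψ₀ G * Ψ₀ H) +
          ∫ s in (0 : ℝ)..t, ω (Ψ s.toNNReal (generator F C G) * Ψ₀ H) :=
  ito_formula hB hF hΨ₀ hΨ G H t
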